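/- Let $K$ be a field, let $n$ be a positive integer, let $S=K[x_1,\dots,x_n]$, and let $\lambda=(\lambda_1\ge\lambda_2\ge\cdots\ge\lambda_m\ge 0)$ be a partition of $n$. A tableau of shape $\lambda$ is a bijective filling of the boxes of the Young diagram of $\lambda$ by $1,\dots,n$. The Specht polynomial $f_T$ of a tableau $T$ is the product of all $x_i-x_j$ such that $i$ and $j$ are in the same column of $T$ and $j$ is in a lower position than $i$. The Specht ideal $I_\lambda\subset S$ is the ideal generated by the polynomials $f_T$ for all tableaux $T$ of shape $\lambda$. For a monomial order $<$ on $S$, the initial ideal $\operatorname{in}_<(I_\lambda)$ is the ideal generated by the leading terms of the elements of $I_\lambda$. For $\sigma\in\mathfrak S_n$, let $\prec_\sigma$ be the lexicographic order with $x_{\sigma(1)}\prec_\sigma x_{\sigma(2)}\prec_\sigma\cdots\prec_\sigma x_{\sigma(n)}$. **Proposition.** Suppose that $\lambda_{i-1}=\lambda_i>0$ for some $i$ with $2\le i\le m$. Then: 1. As $<$ ranges over all monomial orders on $S$, the ideal $I_\lambda$ has exactly $n!$ distinct initial ideals $\operatorname{in}_<(I_\lambda)$. 2. The set of these initial ideals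 equals $\{\operatorname{in}_{\prec_\sigma}(I_\lambda)\mid\sigma\in\mathfrak S_n\}$. 3. The permutation $\sigma$ can be recovered from $\operatorname{in}_{\prec_\sigma}(I_\lambda)$: if $\operatorname{in}_{\prec_\sigma}(I_\lambda)=\operatorname{in}_{\prec_{\sigma'}}(I_\lambda)$, then $\sigma=\sigma'$. -/

import Mathlib

namespace SpechtIdeal

/-- A (Young) tableau of shape `μ` with entries in `Fin n`: a bijective filling of the boxes of the
Young diagram `μ`. The box `(i, j)` lies in row `i` and column `j` (both counted from `0`). -/
abbrev Tableau (μ : YoungDiagram) (n : ℕ) : Type := {c : ℕ × ℕ // c ∈ μ.cells} ≃ Fin n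

/-- The Specht polynomial of a tableau: the product of all `x_i - x_j` such that `i` and `j` are in
the same column of the tableau and `j` is in a lower position than `i`. -/
noncomputable def spechtPolynomial (K : Type*) [Field K] {μ : YoungDiagram} {n : ℕ}
    (T : Tableau μ n) : MvPolynomial (Fin n) K :=
  ∏ p : {c : ℕ × ℕ // c ∈ μ.cells} × {c : ℕ × ℕ // c ∈ μ.cells} with
      p.1.1.2 = p.2.1.2 ∧ p.1.1.1 < p.2.1.1,
    (MvPolynomial.X (T p.1) - MvPolynomial.X (T p.2))

/-- The Specht ideal of shape `μ` in `K[x_0, …, x_{n-1}]`. -/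
noncomputable def spechtIdeal (K : Type*) [Field K] (μ : YoungDiagram) (n : ℕ) :
    Ideal (MvPolynomial (Fin n) K) :=
  Ideal.span (Set.range fun T : Tableau μ n => spechtPolynomial K T)

/-- The initial ideal of `I` with respect to the monomial order `m`: the ideal generated by the
leading terms of the elements of `I`. -/
noncomputable def initialIdeal {K : Type*} [Field K] {n : ℕ} (m : MonomialOrder (Fin n))
    (I : Ideal (MvPolynomial (Fin n) K)) : Ideal (MvPolynomial (Fin n) K) :=
  Ideal.span (m.leadingTerm '' (I : Set (MvPolynomial (Fin n) K)))

/-- The lexicographic order on monomials in `x_0, …, x_{n-1}` with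
`x_{σ 0} ≺ x_{σ 1} ≺ ⋯ ≺ x_{σ (n-1)}`. Mathlib's lexicographic order makes the variable with
index `0` the largest one, so the variable `x_{σ k}` is renamed to the one with index `n - 1 - k`. -/
noncomputable def lexOrder {n : ℕ} (σ : Equiv.Perm (Fin n)) : MonomialOrder (Fin n) where
  syn := (MonomialOrder.lex (σ := Fin n)).syn
  toSyn := (Finsupp.domCongr (σ.symm.trans Fin.revPerm)).trans
    (MonomialOrder.lex (σ := Fin n)).toSyn
  toSyn_monotone := by
    intro a b h
    exact (MonomialOrder.lex (σ := Fin n)).toSyn_monotone fun i => h _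

end SpechtIdeal

/-! List the variables from the largest to the smallest and count rows from 0. A monomial lies in
the lexicographic initial ideal of the Specht ideal exactly when its exponents are bounded below,
entry by entry, by a lattice word that has, for each `j ≥ 1`, at least as many letters `≥ j` as the
diagram has boxes in rows `≥ j`.

Necessity comes from vanishing. A Specht polynomial survives an identification of variables only if
no column contains two identified ones, which bounds the sizes of the blocks. Peeling off the
largest variable and counting roots turns this into a lattice word below the leading exponent
(`VanishesOff.exists_isLattice_le_degree`). For sufficiency, the word distributes the variables into
columns (`IsLattice.exists_columns`). The product of differences within these columns has the word
as its leading exponent, and it lies in the ideal by repeated Lagrange interpolation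
(`columnPolynomial_mem_of_dominates`).

The leading exponents of these products depend only on how the monomial order sorts the variables.
So the initial ideal of any order contains the lexicographic one with the same sorting, and nested
initial ideals of one ideal are equal (`initialIdeal_eq_of_le`). This leaves only the lexicographic
initial ideals.

They are distinct because two equal positive rows force every admissible word of least sum to
contain some `a` and `a + 1` equally often. Putting such letters on two candidates for the largest
variable gives a word that is lattice for one order and not for the other
(`head_eq_of_wordExponents_eq`). The largest variable is then deleted and the argument repeated,
until so few variables remain that the word is forced. -/

namespace SpechtIdeal

/-! ### Lattice words and their contents. -/

/-- A word, read from its last letter to its first one, is a lattice word if each of its final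
segments contains every letter `i` at least as often as the letter `i + 1`. -/
def IsLattice : List ℕ → Prop
  | [] => True
  | a :: u => Antitone (fun i => (a :: u).count i) ∧ IsLattice u

/-- For every `j ≥ 1`, the word has at least `t j` letters which are at least `j`. -/
def TailsGE (t : ℕ → ℕ) (u : List ℕ) : Prop :=
  ∀ j, t (j + 1) ≤ u.countP (fun x => j + 1 ≤ x)

theorem IsLattice.antitone {u : List ℕ} (h : IsLattice u) : Antitone fun i => u.count i := by
  cases u with
  | nil => simpa using antitone_const
  | cons a u => exact h.1

theorem IsLattice.of_append {u v : List ℕ} (h : IsLattice (u ++ v)) : IsLattice v := by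
  induction u with
  | nil => exact h
  | cons a u ih => exact ih h.2

/-- A letter `x` needs `x - 1` after it, which needs `x - 2` after it, and so on down to 0. -/
theorem IsLattice.lt_length {u : List ℕ} (h : IsLattice u) {x : ℕ} (hx : x ∈ u) :
    x < u.length := by
  induction u generalizing x with
  | nil => simp at hx
  | cons a u ih =>
    have key : ∀ y ∈ u, y < (a :: u).length := fun y hy => by
      have := ih h.2 hy
      simp only [List.length_cons]; omega
    rcases List.mem_cons.1 hx with rfl | hx
    · cases x with
      | zero => simp
      | succ y =>
        have h1 := h.1 (Nat.le_succ y)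
        have h2 : 0 < u.count y := by
          simp only [List.count_cons, Nat.succ_eq_add_one] at h1
          simp at h1
          omega
        have := ih h.2 (List.count_pos_iff.1 h2)
        simp only [List.length_cons]; omega
    · exact key x hx

theorem isLattice_zero_cons {u : List ℕ} (h : IsLattice u) : IsLattice (0 :: u) := by
  refine ⟨antitone_nat_of_succ_le fun i => ?_, h⟩
  have := h.antitone (Nat.le_succ i)
  simp only [List.count_cons, Nat.succ_eq_add_one] at this ⊢
  simp
  omega

theorem antitone_count_erase {v : List ℕ} {s : ℕ} (h : Antitone fun i => v.count i)
    (hs : v.count (s + 1) < v.count s) : Antitone fun i => (v.erase s).count i := by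
  refine antitone_nat_of_succ_le fun i => ?_
  have := h (Nat.le_succ i)
  simp only [List.count_erase, beq_iff_eq, Nat.succ_eq_add_one] at this ⊢
  split_ifs <;> subst_vars <;> omega

theorem exists_max_mem {v : List ℕ} (hv : v ≠ []) : ∃ s ∈ v, ∀ x ∈ v, x ≤ s := by
  obtain ⟨s, hs, h⟩ := v.toFinset.exists_max_image id (by simpa using hv)
  exact ⟨s, by simpa using hs, fun x hx => h x (by simpa using hx)⟩

theorem antitone_count_of_perm {u v : List ℕ} (h : u.Perm v) (hv : Antitone fun i => v.count i) :
    Antitone fun i => u.count i := by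
  have : (fun i => u.count i) = fun i => v.count i := funext fun i => h.count_eq i
  rwa [this]

/-- The largest letter can always be put in front: removing one copy of it keeps the multiplicities
weakly decreasing. -/
theorem exists_perm_isLattice (v : List ℕ) (hv : Antitone fun i => v.count i) :
    ∃ u : List ℕ, u.Perm v ∧ IsLattice u := by
  induction hn : v.length generalizing v with
  | zero => exact ⟨v, .refl _, by rw [List.length_eq_zero_iff.1 hn]; trivial⟩
  | succ n ih =>
    have hne : v ≠ [] := by rintro rfl; simp at hn
    obtain ⟨s, hs, hmax⟩ := exists_max_mem hne
    have h0 : v.count (s + 1) = 0 := List.count_eq_zero.2 fun h => by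
      have := hmax _ h
      omega
    have hp : 0 < v.count s := List.count_pos_iff.2 hs
    obtain ⟨u, hu, hl⟩ := ih (v.erase s) (antitone_count_erase hv (by omega))
      (by rw [List.length_erase_of_mem hs]; omega)
    have hperm : (s :: u).Perm v := (hu.cons s).trans (List.perm_cons_erase hs).symm
    exact ⟨s :: u, hperm, antitone_count_of_perm hperm hv, hl⟩

/-- If every removal spoiled the drop after `a`, there would be no drop except the one at `a`, of
size one. The content would then be `0, …, a` once each, which is too short. -/
theorem exists_removable {v : List ℕ} {a : ℕ} (hv : Antitone fun i => v.count i)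
    (ha : v.count (a + 1) < v.count a) (hlen : a + 1 < v.length) :
    ∃ s, v.count (s + 1) < v.count s ∧
      (v.erase s).count (a + 1) < (v.erase s).count a := by
  by_contra! H
  have hne : ∀ s, s ≠ a → v.count (s + 1) = v.count s := by
    intro s hs
    by_contra hcon
    have h1 : v.count (s + 1) < v.count s := lt_of_le_of_ne (hv (Nat.le_succ s)) hcon
    have h2 := H s h1
    simp only [List.count_erase, beq_iff_eq, if_neg hs] at h2
    omega
  have hgt : ∀ x ∈ v, x ≤ a := by
    obtain ⟨s, hs, hmax⟩ := exists_max_mem (v := v) (by rintro rfl; simp at hlen)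
    intro x hx
    refine (hmax x hx).trans (not_lt.1 fun hlt => ?_)
    have h1 := hne s (by omega)
    have h2 : v.count (s + 1) = 0 := List.count_eq_zero.2 fun h => by
      have := hmax _ h
      omega
    have h3 : 0 < v.count s := List.count_pos_iff.2 hs
    omega
  have hz : v.count (a + 1) = 0 := List.count_eq_zero.2 fun h => by
    have := hgt _ h
    omega
  have hone : v.count a = 1 := by
    have h2 := H a ha
    simp only [List.count_erase, beq_iff_eq, if_true] at h2
    simp at h2
    omega
  have hall : ∀ k, k ≤ a → v.count (a - k) = 1 := by
    intro k hk
    induction k with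
    | zero => simpa using hone
    | succ k ih =>
      have := hne (a - (k + 1)) (by omega)
      rw [show a - (k + 1) + 1 = a - k by omega, ih (by omega)] at this
      exact this.symm
  have hperm : v.Perm (List.range (a + 1)) := by
    refine List.perm_iff_count.2 fun i => ?_
    by_cases hi : i ≤ a
    · rw [List.count_eq_one_of_mem List.nodup_range (by simpa using (by omega : i < a + 1))]
      have := hall (a - i) (by omega)
      rwa [show a - (a - i) = i by omega] at this
    · rw [List.count_eq_zero.2 fun h => hi (hgt _ h), List.count_eq_zero.2]
      simp; omega
  have := hperm.length_eq
  simp at this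
  omega

/-- Controls the position of one letter: removable letters are spent in front until exactly `j + 1`
remain, keeping `a` removable throughout. The bound `a ≤ j` is forced by `IsLattice.lt_length`. -/
theorem exists_isLattice_letter_at (v : List ℕ) (hv : Antitone fun i => v.count i) {a j : ℕ}
    (ha : v.count (a + 1) < v.count a) (haj : a ≤ j) (hj : j < v.length) :
    ∃ u₁ u₂ : List ℕ, (u₁ ++ a :: u₂).Perm v ∧ IsLattice (u₁ ++ a :: u₂) ∧ u₂.length = j := by
  induction hn : v.length generalizing v with
  | zero => omega
  | succ n ih =>
    rcases (show j = n ∨ j < n by omega) with rfl | hjn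
    · have hmem : a ∈ v := List.count_pos_iff.1 (by omega)
      obtain ⟨u, hu, hl⟩ := exists_perm_isLattice _ (antitone_count_erase hv ha)
      have hperm : (a :: u).Perm v := (hu.cons a).trans (List.perm_cons_erase hmem).symm
      refine ⟨[], u, hperm, ⟨antitone_count_of_perm hperm hv, hl⟩, ?_⟩
      rw [hu.length_eq, List.length_erase_of_mem hmem]
      omega
    · obtain ⟨s, hs, hs'⟩ := exists_removable hv ha (by omega)
      have hmem : s ∈ v := List.count_pos_iff.1 (by omega)
      have hlen : (v.erase s).length = n := by
        rw [List.length_erase_of_mem hmem]; omega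
      obtain ⟨u₁, u₂, hp, hl, h2⟩ := ih (v.erase s) (antitone_count_erase hv hs) hs'
        (by omega) hlen
      have hperm : (s :: (u₁ ++ a :: u₂)).Perm v :=
        (hp.cons s).trans (List.perm_cons_erase hmem).symm
      exact ⟨s :: u₁, u₂, hperm, ⟨antitone_count_of_perm hperm hv, hl⟩, h2⟩

/-- With at most one 0 no letter repeats, so each new letter must be the next unused one. -/
theorem IsLattice.eq_reverse_range {u : List ℕ} (h : IsLattice u) (h0 : u.count 0 ≤ 1) :
    u = (List.range u.length).reverse := by
  induction u with
  | nil => simp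
  | cons a u ih =>
    have hu := ih h.2 (le_trans (by rw [List.count_cons]; omega) h0)
    have h1 : a < (a :: u).length := h.lt_length (by simp)
    have h2 : (a :: u).count a ≤ 1 := (h.1 (Nat.zero_le a)).trans h0
    have h3 : a ∉ u := by
      intro hmem
      have := List.count_pos_iff.2 hmem
      rw [List.count_cons_self] at h2
      omega
    rw [hu] at h3
    simp only [List.mem_reverse, List.mem_range, not_lt] at h3
    simp only [List.length_cons] at h1
    rw [List.length_cons, List.range_succ, List.reverse_append, ← hu]
    simp; omega

theorem isLattice_reverse_range (n : ℕ) : IsLattice (List.range n).reverse := by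
  have hcount : ∀ n, Antitone fun i => (List.range n).reverse.count i := fun n =>
    antitone_nat_of_succ_le fun i => by
      rw [List.count_reverse, List.count_reverse]
      by_cases hi : i + 1 < n
      · rw [List.count_eq_one_of_mem List.nodup_range (by simpa using hi),
          List.count_eq_one_of_mem List.nodup_range (by simp; omega)]
      · rw [List.count_eq_zero.2 (by simpa using hi)]
        exact Nat.zero_le _
  induction n with
  | zero => trivial
  | succ n ih =>
    have := hcount (n + 1)
    rw [List.range_succ, List.reverse_append] at this ⊢
    exact ⟨this, ih⟩

theorem countP_succ_le (u : List ℕ) (j : ℕ) :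
    u.countP (fun x => j ≤ x) = u.count j + u.countP (fun x => j + 1 ≤ x) := by
  induction u with
  | nil => simp
  | cons a u ih =>
    simp only [List.countP_cons, List.count_cons, ih, decide_eq_true_eq, beq_iff_eq]
    split_ifs <;> omega

theorem countP_zero_le (u : List ℕ) : u.countP (fun x => 0 ≤ x) = u.length := by
  simp

theorem TailsGE.of_perm {t : ℕ → ℕ} {u v : List ℕ} (h : u.Perm v) (hv : TailsGE t v) :
    TailsGE t u := fun j => by rw [h.countP_eq]; exact hv j

/-- Otherwise the multiplicities decrease strictly while positive. Then any excess in a tail could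
be removed by lowering one letter, so minimality makes the tails equal to `t`. The multiplicities of
positive letters are then the row lengths, and 0 occurs at most `lam 0` times, contradicting the two
equal rows. -/
theorem exists_repeated_letter {t lam : ℕ → ℕ} (hlam : ∀ j, t j = lam j + t (j + 1))
    {i : ℕ} (hi : lam i = lam (i + 1)) (hpos : 0 < lam (i + 1)) {u : List ℕ}
    (hu : IsLattice u) (ht : TailsGE t u) (hlen : u.length ≤ t 0)
    (hmin : ∀ v, IsLattice v → TailsGE t v → v.length = u.length → u.sum ≤ v.sum) :
    ∃ a, u.count (a + 1) = u.count a ∧ 0 < u.count (a + 1) ∧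
      u.count (a + 2) < u.count (a + 1) := by
  have hanti := hu.antitone
  suffices h : ∃ a, u.count (a + 1) = u.count a ∧ 0 < u.count (a + 1) by
    classical
    -- The greatest such `a` also has a strict drop after `a + 1`.
    obtain ⟨a, ha⟩ := h
    have hb : ∀ a, (u.count (a + 1) = u.count a ∧ 0 < u.count (a + 1)) → a ≤ u.length := by
      intro a h
      have := hu.lt_length (List.count_pos_iff.1 h.2)
      omega
    have hspec := Nat.findGreatest_spec (P := fun a => u.count (a + 1) = u.count a ∧
      0 < u.count (a + 1)) (hb a ha) ha
    set m := Nat.findGreatest (fun a => u.count (a + 1) = u.count a ∧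
      0 < u.count (a + 1)) u.length with hm
    refine ⟨m, hspec.1, hspec.2, lt_of_le_of_ne (hanti (Nat.le_succ (m + 1))) fun heq => ?_⟩
    have h' : u.count (m + 1 + 1) = u.count (m + 1) ∧ 0 < u.count (m + 1 + 1) :=
      ⟨heq, by rw [heq]; exact hspec.2⟩
    have := Nat.le_findGreatest (P := fun a => u.count (a + 1) = u.count a ∧
      0 < u.count (a + 1)) (hb _ h') h'
    omega
  by_contra! H
  have hstrict : ∀ a, 0 < u.count (a + 1) → u.count (a + 1) < u.count a := fun a ha =>
    lt_of_le_of_ne (hanti (Nat.le_succ a)) fun h => by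
      have := H a h
      omega
  have htail : ∀ a, u.countP (fun x => a + 1 ≤ x) = t (a + 1) := by
    intro a
    refine le_antisymm (not_lt.1 fun hlt => ?_) (ht a)
    have hmem : a + 1 ∈ u := by
      obtain ⟨x, hx, hax⟩ := List.countP_pos_iff.1 (lt_of_le_of_lt (Nat.zero_le _) hlt)
      have h1 := List.count_pos_iff.2 hx
      have h2 := hanti (of_decide_eq_true hax)
      exact List.count_pos_iff.1 (lt_of_lt_of_le h1 h2)
    have hp := List.count_pos_iff.2 hmem
    have hperm := List.perm_cons_erase hmem
    -- Replacing one `a + 1` by `a` keeps the content weakly decreasing by strictness, affects only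
    -- the tail with slack, and lowers the sum by one.
    have hv : Antitone fun i => (a :: u.erase (a + 1)).count i := by
      refine antitone_nat_of_succ_le fun k => ?_
      have h1 := hanti (Nat.le_succ k)
      have h2 := hstrict k
      have h3 := hstrict a hp
      simp only [List.count_cons, List.count_erase, beq_iff_eq, Nat.succ_eq_add_one] at h1 ⊢
      split_ifs <;> subst_vars <;> omega
    obtain ⟨v, hvp, hvl⟩ := exists_perm_isLattice _ hv
    have hsum := hmin v hvl ?_ ?_
    · rw [hvp.sum_eq, hperm.sum_eq] at hsum
      simp at hsum
    · refine TailsGE.of_perm hvp fun j => ?_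
      have h1 := ht j
      rw [hperm.countP_eq] at h1 hlt
      simp only [List.countP_cons, decide_eq_true_eq] at h1 hlt ⊢
      by_cases hj : j = a
      · subst hj
        simp at hlt ⊢
        omega
      · split_ifs at h1 ⊢ <;> omega
    · rw [hvp.length_eq, hperm.length_eq]
      simp
  have hcount : ∀ a, u.count (a + 1) = lam (a + 1) := by
    intro a
    have h1 := countP_succ_le u (a + 1)
    rw [htail, htail, hlam (a + 1)] at h1
    omega
  have hzero : u.count 0 ≤ lam 0 := by
    have h1 := countP_succ_le u 0
    rw [countP_zero_le, htail] at h1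
    have := hlam 0
    omega
  have h1 := hstrict i (by rw [hcount]; exact hpos)
  cases i with
  | zero => rw [hcount] at h1; omega
  | succ i => rw [hcount, hcount] at h1; omega

/-! ### Recovering the order of the variables from the exponents. -/

section Words

variable {V : Type*}

/-- The exponents which are bounded below by a lattice word along the list `l` of variables
having enough large letters. -/
def wordExponents (t : ℕ → ℕ) (l : List V) : Set (V → ℕ) :=
  {e | ∃ w : V → ℕ, (∀ x, w x ≤ e x) ∧ IsLattice (l.map w) ∧ TailsGE t (l.map w)}

theorem exists_map_eq {l : List V} (hl : l.Nodup) {u : List ℕ} (h : u.length = l.length) :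
    ∃ w : V → ℕ, l.map w = u := by
  classical
  -- The default 0 is only taken at variables outside `l`.
  refine ⟨fun x => u.getD (l.idxOf x) 0, List.ext_getElem (by simp [h]) fun i h1 h2 => ?_⟩
  simp only [List.length_map] at h1
  simp [hl.idxOf_getElem, List.getElem?_eq_getElem h2]

theorem eq_of_sum_map_le {l : List V} {w w' : V → ℕ} (hle : ∀ x, w' x ≤ w x)
    (hsum : (l.map w).sum ≤ (l.map w').sum) : ∀ x ∈ l, w' x = w x := by
  induction l with
  | nil => simp
  | cons a l ih =>
    have h1 : (l.map w').sum ≤ (l.map w).sum := List.sum_le_sum fun x _ => hle x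
    have h2 := hle a
    simp only [List.map_cons, List.sum_cons] at hsum
    intro x hx
    rcases List.mem_cons.1 hx with rfl | hx
    · omega
    · exact ih (by omega) x hx

/-- A word of least sum has no room below it: the lattice word along `l'` that bounds it from below
has at least the same sum, hence equals it. -/
theorem map_eq_of_wordExponents_subset {t : ℕ → ℕ} {l l' : List V} (hp : l.Perm l')
    (h : wordExponents t l ⊆ wordExponents t l') {w : V → ℕ} (hw : IsLattice (l.map w))
    (ht : TailsGE t (l.map w))
    (hmin : ∀ v, IsLattice v → TailsGE t v → v.length = l.length → (l.map w).sum ≤ v.sum) :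
    IsLattice (l'.map w) := by
  obtain ⟨w', hle, hl', ht'⟩ := h ⟨w, fun _ => le_rfl, hw, ht⟩
  have hs := hmin _ hl' ht' (by simpa using hp.symm.length_eq)
  rw [(hp.map w).sum_eq] at hs
  rwa [← List.map_congr_left (eq_of_sum_map_le hle hs)]

/-- Restricting to exponent 0 at `b` deletes `b`, because a leading 0 never affects the lattice
condition or the tails. -/
theorem wordExponents_subset_of_cons {t : ℕ → ℕ} {b : V} {k k' : List V} (hb : b ∉ k)
    (hb' : b ∉ k') (h : wordExponents t (b :: k) ⊆ wordExponents t (b :: k')) :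
    wordExponents t k ⊆ wordExponents t k' := by
  classical
  rintro e ⟨w, hle, hw, ht⟩
  have hmap : ∀ {k : List V} (f : V → ℕ), b ∉ k → k.map (Function.update f b 0) = k.map f :=
    fun f hb => List.map_congr_left fun x hx => Function.update_of_ne (by rintro rfl; exact hb hx) ..
  have hmem : Function.update e b 0 ∈ wordExponents t (b :: k) := by
    refine ⟨Function.update w b 0, fun x => ?_, ?_, fun j => ?_⟩
    · by_cases hx : x = b
      · subst hx; simp
      · simpa [Function.update_of_ne hx] using hle x
    · rw [List.map_cons, hmap w hb, Function.update_self]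
      exact isLattice_zero_cons hw
    · rw [List.map_cons, hmap w hb, Function.update_self]
      simpa [List.countP_cons] using ht j
  obtain ⟨w', hle', hw', ht'⟩ := h hmem
  have h0 : w' b = 0 := by simpa using hle' b
  refine ⟨Function.update w' b 0, fun x => ?_, ?_, fun j => ?_⟩
  · by_cases hx : x = b
    · subst hx; simp
    · simpa [Function.update_of_ne hx] using hle' x
  · rw [hmap w' hb']
    exact hw'.2
  · rw [hmap w' hb']
    simpa [List.countP_cons, h0] using ht' j

theorem tailsGE_reverse_range {t : ℕ → ℕ} (ht : ∀ j, 0 < t (j + 1) → t (j + 1) + j ≤ t 1)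
    {N : ℕ} (hN : t 1 + 1 ≤ N) : TailsGE t (List.range N).reverse := by
  have key : ∀ j N, N - j ≤ (List.range N).countP (fun x => j ≤ x) := by
    intro j N
    induction N with
    | zero => simp
    | succ N ih =>
      simp only [List.range_succ, List.countP_append, List.countP_cons, List.countP_nil,
        decide_eq_true_eq]
      split_ifs <;> omega
  intro j
  rw [List.countP_reverse]
  have h1 := key (j + 1) N
  have h2 := ht j
  omega

/-- The bound on `N` makes `N - 1, …, 1, 0` admissible, so the set of sums to minimise over is
nonempty. -/
theorem exists_minimal_word {t : ℕ → ℕ} (ht : ∀ j, 0 < t (j + 1) → t (j + 1) + j ≤ t 1)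
    {N : ℕ} (hN : t 1 + 1 ≤ N) : ∃ u, IsLattice u ∧ TailsGE t u ∧ u.length = N ∧
      ∀ v, IsLattice v → TailsGE t v → v.length = N → u.sum ≤ v.sum := by
  classical
  have hex : ∃ s, ∃ u, IsLattice u ∧ TailsGE t u ∧ u.length = N ∧ u.sum = s :=
    ⟨_, _, isLattice_reverse_range N, tailsGE_reverse_range ht hN, by simp, rfl⟩
  obtain ⟨u, h1, h2, h3, h4⟩ := Nat.find_spec hex
  exact ⟨u, h1, h2, h3, fun v a b c => h4 ▸ Nat.find_min' hex ⟨v, a, b, c, rfl⟩⟩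

/-- A minimal word with `a` and `a + 1` equally frequent is arranged along one list and carried to
the other by minimality. Which list is used depends on whether enough variables follow `b'` for the
letter `a` to sit there. -/
theorem head_eq_of_wordExponents_eq {t lam : ℕ → ℕ} (hlam : ∀ j, t j = lam j + t (j + 1))
    {i : ℕ} (hi : lam i = lam (i + 1)) (hpos : 0 < lam (i + 1))
    (ht : ∀ j, 0 < t (j + 1) → t (j + 1) + j ≤ t 1) {b b' : V} {k k' : List V}
    (hnd : (b :: k).Nodup) (hp : (b :: k).Perm (b' :: k')) (hN : t 1 + 1 ≤ (b :: k).length)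
    (hN' : (b :: k).length ≤ t 0)
    (h : wordExponents t (b :: k) = wordExponents t (b' :: k')) : b = b' := by
  by_contra hbb
  obtain ⟨u, hu, htu, hlen, hmin⟩ := exists_minimal_word ht hN
  obtain ⟨a, ha1, ha2, ha3⟩ := exists_repeated_letter hlam hi hpos hu htu (hlen ▸ hN')
    fun v a b c => hmin v a b (c.trans hlen)
  have hmem : a + 1 ∈ u := List.count_pos_iff.1 ha2
  have hperm := List.perm_cons_erase hmem
  have hanti := antitone_count_erase hu.antitone ha3
  have hb'k : b' ∈ k := by
    have : b' ∈ b :: k := hp.mem_iff.2 (by simp)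
    exact (List.mem_cons.1 this).resolve_left (Ne.symm hbb)
  obtain ⟨k₁, k₂, rfl⟩ := List.append_of_mem hb'k
  have hlen' : (u.erase (a + 1)).length = k₁.length + (k₂.length + 1) := by
    rw [List.length_erase_of_mem hmem, hlen]
    simp
  rcases le_or_gt a k₂.length with haj | haj
  -- Put `a + 1` on `b` and `a` on `b'`. Along the other list `a` comes first, and what follows it
  -- has more letters `a + 1` than `a`.
  · have hcount : (u.erase (a + 1)).count (a + 1) < (u.erase (a + 1)).count a := by
      simp only [List.count_erase]
      simp
      omega
    obtain ⟨u₁, u₂, hup, hul, hu2⟩ := exists_isLattice_letter_at _ hanti hcount haj (by omega)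
    have hvp : ((a + 1) :: (u₁ ++ a :: u₂)).Perm u := (hup.cons _).trans hperm.symm
    have hvl : IsLattice ((a + 1) :: (u₁ ++ a :: u₂)) :=
      ⟨antitone_count_of_perm hvp hu.antitone, hul⟩
    obtain ⟨w, hw⟩ := exists_map_eq hnd (hvp.length_eq.trans hlen)
    have hu1 : u₁.length = k₁.length := by
      have := hup.length_eq
      simp [hlen'] at this
      omega
    have hwb : w b' = a := by
      simp only [List.map_cons, List.map_append, List.cons.injEq] at hw
      have := List.append_inj_right hw.2 (by simpa using hu1.symm)
      simpa using (List.cons.inj this).1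
    have hl' := map_eq_of_wordExponents_subset hp h.subset (by rw [hw]; exact hvl)
      (by rw [hw]; exact htu.of_perm hvp)
      (fun v a b c => by rw [hw, hvp.sum_eq]; exact hmin v a b c)
    have hcnt : ∀ x, ((b' :: k').map w).count x = u.count x := fun x => by
      rw [← hvp.count_eq x, ← hw]
      exact ((hp.map w).count_eq x).symm
    have h1 := hl'.2.antitone (Nat.le_succ a)
    have h2 := hcnt a
    have h3 := hcnt (a + 1)
    simp only [List.map_cons, hwb, List.count_cons] at h1 h2 h3
    simp at h1 h2 h3
    omega
  -- Put `a + 1` on `b'` at the head of the second list. Along the first list only `k₂` follows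
  -- `b'`, which is too short for that letter.
  · obtain ⟨u₀, hup, hul⟩ := exists_perm_isLattice _ hanti
    have hvp : ((a + 1) :: u₀).Perm u := (hup.cons _).trans hperm.symm
    have hvl : IsLattice ((a + 1) :: u₀) := ⟨antitone_count_of_perm hvp hu.antitone, hul⟩
    obtain ⟨w, hw⟩ := exists_map_eq (hp.nodup_iff.1 hnd)
      (hvp.length_eq.trans (hlen.trans hp.length_eq))
    have hwb : w b' = a + 1 := by simpa using (List.cons.inj hw).1
    have hl' := map_eq_of_wordExponents_subset hp.symm h.symm.subset (by rw [hw]; exact hvl)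
      (by rw [hw]; exact htu.of_perm hvp)
      (fun v a b c => by rw [hw, hvp.sum_eq]; exact hmin v a b (c.trans hp.length_eq.symm))
    have h1 : IsLattice ((b' :: k₂).map w) := by
      rw [List.map_cons, List.map_append] at hl'
      exact hl'.2.of_append
    have h2 := h1.lt_length (x := w b') (by simp)
    simp at h2
    omega

/-- At this length the tail condition leaves room for only one 0, so `N - 1, …, 0` is the only
admissible word. Its letters are distinct and therefore record the order. -/
theorem eq_of_wordExponents_eq_of_length {t : ℕ → ℕ}
    (ht : ∀ j, 0 < t (j + 1) → t (j + 1) + j ≤ t 1) {l l' : List V}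
    (hnd : l.Nodup) (hp : l.Perm l') (hN : l.length = t 1 + 1)
    (h : wordExponents t l = wordExponents t l') : l = l' := by
  obtain ⟨e, he⟩ := exists_map_eq hnd (u := (List.range l.length).reverse) (by simp)
  have hmem : e ∈ wordExponents t l := ⟨e, fun _ => le_rfl, by
    rw [he]; exact isLattice_reverse_range _, by
    rw [he]; exact tailsGE_reverse_range ht hN.ge⟩
  rw [h] at hmem
  obtain ⟨w, hle, hw, htw⟩ := hmem
  have h0 : (l'.map w).count 0 ≤ 1 := by
    have h1 := countP_succ_le (l'.map w) 0
    rw [countP_zero_le, List.length_map, ← hp.length_eq] at h1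
    have := htw 0
    simp only [Nat.zero_add] at this h1
    omega
  have hwr := hw.eq_reverse_range h0
  rw [List.length_map, ← hp.length_eq, ← he] at hwr
  have hs : (l'.map e).sum ≤ (l'.map w).sum := by
    rw [hwr, (hp.map e).sum_eq]
  rw [List.map_congr_left (eq_of_sum_map_le hle hs)] at hwr
  have hinj : Set.InjOn e {x | x ∈ l} := by
    refine List.inj_on_of_nodup_map ?_
    rw [he]
    simpa using List.nodup_range
  have hmap : ∀ (m m' : List V), (∀ x ∈ m, x ∈ l) → (∀ x ∈ m', x ∈ l) →
      m.map e = m'.map e → m = m' := by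
    intro m
    induction m with
    | nil => intro m' _ _ hm; simpa using hm.symm
    | cons a m ih =>
      intro m' h1 h2 hm
      cases m' with
      | nil => simp at hm
      | cons a' m' =>
        simp only [List.map_cons, List.cons.injEq] at hm
        rw [hinj (h1 a (by simp)) (h2 a' (by simp)) hm.1,
          ih m' (fun x hx => h1 x (by simp [hx])) (fun x hx => h2 x (by simp [hx])) hm.2]
  exact hmap l l' (fun _ hx => hx) (fun x hx => hp.mem_iff.2 hx) hwr.symm

theorem eq_of_wordExponents_eq {t lam : ℕ → ℕ} (hlam : ∀ j, t j = lam j + t (j + 1))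
    {i : ℕ} (hi : lam i = lam (i + 1)) (hpos : 0 < lam (i + 1))
    (ht : ∀ j, 0 < t (j + 1) → t (j + 1) + j ≤ t 1) {l l' : List V}
    (hnd : l.Nodup) (hp : l.Perm l') (hN : t 1 + 1 ≤ l.length) (hN' : l.length ≤ t 0)
    (h : wordExponents t l = wordExponents t l') : l = l' := by
  induction l generalizing l' with
  | nil => exact (List.nil_perm.1 hp).symm
  | cons b k ih =>
    rcases hN.eq_or_lt with hN1 | hN1
    · exact eq_of_wordExponents_eq_of_length ht hnd hp hN1.symm h
    cases l' with
    | nil => simp at hp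
    | cons b' k' =>
      obtain rfl := head_eq_of_wordExponents_eq hlam hi hpos ht hnd hp hN hN' h
      have hk : b ∉ k := (List.nodup_cons.1 hnd).1
      have hk' : b ∉ k' := (List.nodup_cons.1 (hp.nodup_iff.1 hnd)).1
      simp only [List.length_cons] at hN1 hN'
      rw [ih (List.nodup_cons.1 hnd).2 (List.perm_cons _ |>.1 hp) (by omega) (by omega)
        ((wordExponents_subset_of_cons hk hk' h.subset).antisymm
          (wordExponents_subset_of_cons hk' hk h.symm.subset))]

end Words

open MvPolynomial

/-! ### From vanishing under identifications to leading exponents. -/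

section Vanishing

variable {R : Type*} [CommRing R]

/-- `f` vanishes under each identification of the variables, with blocks numbered by weakly
decreasing size, for which the multiset of the numbers of the blocks of the variables is not
in `F`. -/
def VanishesOff (F : Multiset ℕ → Prop) {n : ℕ} (f : MvPolynomial (Fin n) R) : Prop :=
  ∀ φ : Fin n → ℕ, (Antitone fun i => (List.ofFn φ).count i) → ¬ F (List.ofFn φ) →
    rename φ f = 0

theorem rename_cons_eq_eval {n : ℕ} {τ : Type*} (y : τ) (φ : Fin n → τ)
    (f : MvPolynomial (Fin (n + 1)) R) :
    rename (Fin.cons y φ : Fin (n + 1) → τ) f =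
      ((finSuccEquiv R n f).map (rename φ : MvPolynomial (Fin n) R →ₐ[R] _).toRingHom).eval
        (X y) := by
  induction f using MvPolynomial.induction_on with
  | C a => simp [finSuccEquiv_apply]
  | add p q hp hq => simp [hp, hq]
  | mul_X p i hp =>
    rw [map_mul, map_mul, hp, Polynomial.map_mul, Polynomial.eval_mul, rename_X]
    congr 1
    refine Fin.cases ?_ (fun j => ?_) i
    · simp [finSuccEquiv_X_zero]
    · simp [finSuccEquiv_X_succ]

/-- The vanishing hypothesis only covers blocks numbered by weakly decreasing size, and adding a
variable to block `i` may break this. Exchanging the name `i` with that of the first block of equal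
size repairs it, and renaming blocks is injective. -/
theorem rename_cons_eq_zero {F : Multiset ℕ → Prop} {n d : ℕ} {f : MvPolynomial (Fin (n + 1)) R}
    (hf : VanishesOff F f) {φ : Fin n → ℕ} (hφ : Antitone fun i => (List.ofFn φ).count i)
    (hd : ∀ i ≤ d, (Antitone fun j => (i :: List.ofFn φ).count j) →
      ¬ F ((i :: List.ofFn φ : List ℕ))) {i : ℕ} (hi : i ≤ d) :
    rename (Fin.cons i φ : Fin (n + 1) → ℕ) f = 0 := by
  classical
  have hex : ∃ k, (List.ofFn φ).count k = (List.ofFn φ).count i := ⟨i, rfl⟩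
  set k := Nat.find hex with hk
  have hki : k ≤ i := Nat.find_min' hex rfl
  have hkc : (List.ofFn φ).count k = (List.ofFn φ).count i := Nat.find_spec hex
  have hcount : ∀ j, (List.ofFn (Equiv.swap k i ∘ (Fin.cons i φ : Fin (n + 1) → ℕ))).count j =
      (k :: List.ofFn φ).count j := by
    intro j
    rw [← List.map_ofFn, List.ofFn_cons]
    have h1 := List.count_map_of_injective (i :: List.ofFn φ) (Equiv.swap k i)
      (Equiv.swap k i).injective (Equiv.swap k i j)
    rw [Equiv.swap_apply_self] at h1
    rw [h1]
    simp only [List.count_cons, beq_iff_eq]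
    rcases eq_or_ne j k with rfl | hjk
    · rw [Equiv.swap_apply_left, hkc]; simp
    rcases eq_or_ne j i with rfl | hji
    · rw [Equiv.swap_apply_right, hkc]
      simp only [eq_comm]
    · rw [Equiv.swap_apply_of_ne_of_ne hjk hji, if_neg (Ne.symm hji), if_neg (Ne.symm hjk)]
  have hperm := List.perm_iff_count.2 hcount
  have hanti : Antitone fun j => (k :: List.ofFn φ).count j := by
    refine antitone_nat_of_succ_le fun j => ?_
    have h1 := hφ (Nat.le_succ j)
    simp only [List.count_cons, beq_iff_eq, Nat.succ_eq_add_one] at h1 ⊢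
    by_cases hj : k = j + 1
    · have h2 : (List.ofFn φ).count j ≠ (List.ofFn φ).count i :=
        Nat.find_min hex (m := j) (by omega)
      rw [← hkc, hj] at h2
      split_ifs <;> omega
    · split_ifs <;> omega
  have h0 := hf (Equiv.swap k i ∘ (Fin.cons i φ : Fin (n + 1) → ℕ))
    (antitone_count_of_perm hperm hanti) (by
      rw [Multiset.coe_eq_coe.2 hperm]
      exact hd k (hki.trans hi) hanti)
  rw [← rename_rename] at h0
  exact (rename_injective _ (Equiv.swap k i).injective) (by rw [h0, map_zero])

/-- If no block `i ≤ d` can take the first variable, the identified polynomial, of degree at most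
`d` in that variable, has the `d + 1` distinct roots `X 0, …, X d`. So it is zero, and its
coefficient at `d` with it. -/
theorem VanishesOff.leadingCoeff_finSuccEquiv [IsDomain R] {F : Multiset ℕ → Prop} {n : ℕ}
    {f : MvPolynomial (Fin (n + 1)) R} (hf : VanishesOff F f) :
    VanishesOff (fun ν => ∃ i ≤ (finSuccEquiv R n f).natDegree,
      (Antitone fun j => (i ::ₘ ν).count j) ∧ F (i ::ₘ ν))
      (finSuccEquiv R n f).leadingCoeff := by
  intro φ hφ hF
  push Not at hF
  set g := finSuccEquiv R n f
  have hz : g.map (rename φ : MvPolynomial (Fin n) R →ₐ[R] _).toRingHom = 0 := by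
    refine Polynomial.eq_zero_of_natDegree_lt_card_of_eval_eq_zero _
      (f := fun i : Fin (g.natDegree + 1) => (X (i : ℕ) : MvPolynomial ℕ R)) ?_ ?_ ?_
    · exact fun a b hab => Fin.ext (X_injective hab)
    · intro i
      rw [← rename_cons_eq_eval]
      refine rename_cons_eq_zero hf hφ (d := g.natDegree) (fun i hi h => hF i hi ?_)
        (Nat.lt_succ_iff.1 i.2)
      simpa only [Multiset.cons_coe, Multiset.coe_count] using h
    · rw [Fintype.card_fin]
      exact Nat.lt_succ_of_le Polynomial.natDegree_map_le
  have := congrArg (fun p => p.coeff g.natDegree) hz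
  simpa using this

theorem lex_degree_eq_cons [IsDomain R] {n : ℕ} {f : MvPolynomial (Fin (n + 1)) R} (hf : f ≠ 0) :
    MonomialOrder.lex.degree f = Finsupp.cons (finSuccEquiv R n f).natDegree
      (MonomialOrder.lex.degree (finSuccEquiv R n f).leadingCoeff) := by
  set g := finSuccEquiv R n f with hg
  have hg0 : g.leadingCoeff ≠ 0 := by
    rw [Polynomial.leadingCoeff_ne_zero, hg]
    exact (map_ne_zero_iff _ (finSuccEquiv R n).injective).2 hf
  refine MonomialOrder.lex.toSyn.injective (le_antisymm ?_ ?_)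
  · rw [MonomialOrder.degree_le_iff]
    intro c hc
    refine not_lt.1 fun hlt => ?_
    rw [MonomialOrder.lex_lt_iff, Finsupp.Lex.lt_iff] at hlt
    obtain ⟨i, hi, hlt⟩ := hlt
    simp only [ofLex_toLex] at hi hlt
    rw [← Finsupp.cons_tail c] at hc hi hlt
    have hc' : Finsupp.tail c ∈ (g.coeff (c 0)).support := by
      rw [hg, mem_support_coeff_finSuccEquiv]
      exact hc
    have hle : c 0 ≤ g.natDegree := Polynomial.le_natDegree_of_ne_zero (by
      rintro h; rw [h] at hc'; simp at hc')
    revert hi hlt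
    refine Fin.cases ?_ (fun i => ?_) i
    · intro _ hlt
      simp at hlt
      omega
    · intro hi hlt
      have h0 := hi 0 (Fin.succ_pos i)
      simp only [Finsupp.cons_zero] at h0
      rw [← h0] at hc'
      refine absurd (MonomialOrder.lex.le_degree hc') (not_le.2 ?_)
      rw [MonomialOrder.lex_lt_iff, Finsupp.Lex.lt_iff]
      refine ⟨i, fun j hj => ?_, ?_⟩
      · simpa [Finsupp.tail_apply] using hi j.succ (Fin.succ_lt_succ_iff.2 hj)
      · simpa [Finsupp.tail_apply] using hlt
  · refine MonomialOrder.lex.le_degree ?_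
    rw [← mem_support_coeff_finSuccEquiv]
    exact MonomialOrder.lex.degree_mem_support hg0

/-- The condition `F` is left arbitrary so that the induction can absorb the letter chosen for each
peeled variable into it. -/
theorem VanishesOff.exists_isLattice_le_degree [IsDomain R] {n : ℕ} {F : Multiset ℕ → Prop}
    {f : MvPolynomial (Fin n) R} (hf : VanishesOff F f) (h0 : f ≠ 0) :
    ∃ w : Fin n → ℕ, (∀ k, w k ≤ MonomialOrder.lex.degree f k) ∧ IsLattice (List.ofFn w) ∧
      F (List.ofFn w) := by
  induction n generalizing F with
  | zero =>
    refine ⟨Fin.elim0, fun k => k.elim0, by simp [IsLattice], ?_⟩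
    by_contra hF
    refine h0 (rename_injective (Fin.elim0 : Fin 0 → ℕ) (fun a => a.elim0) ?_)
    rw [map_zero]
    exact hf _ (by simpa using antitone_const) hF
  | succ n ih =>
    have hg0 : (finSuccEquiv R n f).leadingCoeff ≠ 0 := by
      rw [Polynomial.leadingCoeff_ne_zero]
      exact (map_ne_zero_iff _ (finSuccEquiv R n).injective).2 h0
    obtain ⟨w, hle, hw, i, hi, hanti, hF⟩ := ih hf.leadingCoeff_finSuccEquiv hg0
    refine ⟨Fin.cons i w, fun k => ?_, ?_, ?_⟩
    · rw [lex_degree_eq_cons h0]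
      refine Fin.cases ?_ (fun k => ?_) k
      · simpa using hi
      · simpa using hle k
    · rw [List.ofFn_cons]
      exact ⟨by simpa only [Multiset.cons_coe, Multiset.coe_count] using hanti, hw⟩
    · rw [List.ofFn_cons]
      exact hF

end Vanishing

/-! ### Row tails of the diagram and elements of the Specht ideal. -/

theorem countP_ofFn {n : ℕ} (w : Fin n → ℕ) (p : ℕ → Prop) [DecidablePred p] :
    (List.ofFn w).countP (fun x => p x) = (Finset.univ.filter fun k => p (w k)).card := by
  induction n with
  | zero => simp
  | succ n ih =>
    rw [List.ofFn_succ, List.countP_cons, ih, Fin.card_filter_univ_succ]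
    simp only [decide_eq_true_eq]
    split_ifs <;> rfl

/-- The number of boxes of a Young diagram in the rows from the `j`-th one on. -/
def rowTail (μ : YoungDiagram) (j : ℕ) : ℕ := (μ.cells.filter fun c => j ≤ c.1).card

theorem rowTail_zero (μ : YoungDiagram) : rowTail μ 0 = μ.card := by
  simp [rowTail, YoungDiagram.card]

theorem rowTail_eq (μ : YoungDiagram) (j : ℕ) :
    rowTail μ j = μ.rowLen j + rowTail μ (j + 1) := by
  rw [rowTail, rowTail, YoungDiagram.rowLen_eq_card, YoungDiagram.row,
    ← Finset.card_union_of_disjoint]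
  · congr 1
    ext c
    simp only [Finset.mem_filter, Finset.mem_union, ← and_or_left]
    refine and_congr_right fun _ => ?_
    omega
  · refine Finset.disjoint_filter.2 fun c _ h1 h2 => ?_
    omega

theorem rowTail_pos_add_le (μ : YoungDiagram) (j : ℕ) (h : 0 < rowTail μ (j + 1)) :
    rowTail μ (j + 1) + j ≤ rowTail μ 1 := by
  induction j with
  | zero => simp
  | succ j ih =>
    have h1 := rowTail_eq μ (j + 1)
    obtain ⟨c, hc⟩ := Finset.card_pos.1 h
    rw [Finset.mem_filter] at hc
    have h2 : 0 < μ.rowLen (j + 1) := YoungDiagram.mem_iff_lt_rowLen.1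
      (μ.up_left_mem (by omega : j + 1 ≤ c.1) (Nat.zero_le c.2) hc.1)
    have := ih (by omega)
    omega

/-- Each column has at most `min j (column length)` entries below `j`, and numbering by rows attains
this. -/
theorem card_filter_le_of_injOn_columns {μ : YoungDiagram} {ψ : {c : ℕ × ℕ // c ∈ μ.cells} → ℕ}
    (hψ : ∀ p q, p.1.2 = q.1.2 → ψ p = ψ q → p = q) (j : ℕ) :
    (Finset.univ.filter fun p => ψ p < j).card ≤
      (Finset.univ.filter fun p : {c : ℕ × ℕ // c ∈ μ.cells} => p.1.1 < j).card := by
  classical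
  have hmaps : ∀ s : Finset {c : ℕ × ℕ // c ∈ μ.cells},
      Set.MapsTo (fun p : {c : ℕ × ℕ // c ∈ μ.cells} => p.1.2) (s : Set _)
        (Finset.univ.image fun p : {c : ℕ × ℕ // c ∈ μ.cells} => p.1.2 : Finset ℕ) :=
    fun s p _ => by simp
  rw [Finset.card_eq_sum_card_fiberwise (hmaps _),
    Finset.card_eq_sum_card_fiberwise (hmaps (Finset.univ.filter fun p => p.1.1 < j))]
  refine Finset.sum_le_sum fun k _ => ?_
  rw [Finset.filter_filter, Finset.filter_filter]
  by_cases hjk : (j, k) ∈ μ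
  · calc (Finset.univ.filter fun p : {c : ℕ × ℕ // c ∈ μ.cells} => ψ p < j ∧ p.1.2 = k).card
        ≤ (Finset.range j).card := by
          refine Finset.card_le_card_of_injOn ψ (fun p hp => ?_) fun p hp q hq h => ?_
          · simp only [Finset.coe_filter, Finset.mem_univ, true_and, Set.mem_ofPred_eq] at hp
            simpa using hp.1
          · simp only [Finset.coe_filter, Finset.mem_univ, true_and, Set.mem_ofPred_eq] at hp hq
            exact hψ p q (hp.2.trans hq.2.symm) h
      _ ≤ _ := by
          have hmem : ∀ i < j, (i, k) ∈ μ.cells := fun i hi => μ.up_left_mem hi.le le_rfl hjk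
          -- The box `(j, k)` is a filler for `i ≥ j`, never reached on `range j`.
          refine Finset.card_le_card_of_injOn
            (fun i => if h : i < j then ⟨(i, k), hmem i h⟩ else ⟨(j, k), hjk⟩)
            (fun i hi => ?_) fun i hi i' hi' h => ?_
          · simp only [Finset.coe_range, Set.mem_Iio] at hi
            simp [hi]
          · simp only [Finset.coe_range, Set.mem_Iio] at hi hi'
            simpa [hi, hi'] using h
  · refine Finset.card_le_card fun p hp => ?_
    simp only [Finset.mem_filter, Finset.mem_univ, true_and] at hp ⊢
    refine ⟨not_le.1 fun hle => hjk ?_, hp.2⟩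
    exact μ.up_left_mem hle hp.2.ge p.2

section Field

variable {K : Type*} [Field K]

theorem tailsGE_of_rename_spechtPolynomial_ne_zero {μ : YoungDiagram} {n : ℕ} (T : Tableau μ n)
    {φ : Fin n → ℕ} (h : rename φ (spechtPolynomial K T) ≠ 0) :
    TailsGE (rowTail μ) (List.ofFn φ) := by
  classical
  have hne : ∀ p q : {c : ℕ × ℕ // c ∈ μ.cells}, p.1.2 = q.1.2 → p.1.1 < q.1.1 →
      φ (T p) ≠ φ (T q) := by
    intro p q h1 h2 h3
    refine h ?_
    rw [spechtPolynomial, map_prod]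
    refine Finset.prod_eq_zero (i := (p, q)) (by simp [h1, h2]) ?_
    simp [h3]
  have hψ : ∀ p q : {c : ℕ × ℕ // c ∈ μ.cells}, p.1.2 = q.1.2 → φ (T p) = φ (T q) → p = q := by
    intro p q h1 h2
    rcases lt_trichotomy p.1.1 q.1.1 with h3 | h3 | h3
    · exact absurd h2 (hne p q h1 h3)
    · exact Subtype.ext (Prod.ext h3 h1)
    · exact absurd h2.symm (hne q p h1.symm h3)
  intro j
  have h1 := card_filter_le_of_injOn_columns (ψ := fun p => φ (T p)) hψ (j + 1)
  rw [countP_ofFn φ fun x => j + 1 ≤ x]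
  have h2 : (Finset.univ.filter fun p => φ (T p) < j + 1).card =
      (Finset.univ.filter fun k => φ k < j + 1).card :=
    Finset.card_equiv T fun p => by simp
  have h3 := Finset.card_filter_add_card_filter_not (s := Finset.univ) fun k => φ k < j + 1
  have h4 := Finset.card_filter_add_card_filter_not (s := Finset.univ)
    fun p : {c : ℕ × ℕ // c ∈ μ.cells} => p.1.1 < j + 1
  have h5 : (Finset.univ.filter fun p : {c : ℕ × ℕ // c ∈ μ.cells} => ¬ p.1.1 < j + 1).card =
      rowTail μ (j + 1) := by
    rw [rowTail]
    refine Finset.card_bij (fun p _ => p.1) (fun p hp => ?_) (fun p _ q _ h => Subtype.ext h)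
      fun c hc => ?_
    · simp only [Finset.mem_filter, Finset.mem_univ, true_and, not_lt] at hp
      exact Finset.mem_filter.2 ⟨p.2, hp⟩
    · rw [Finset.mem_filter] at hc
      exact ⟨⟨c, hc.1⟩, by simpa using hc.2, rfl⟩
  have h6 := Fintype.card_congr T
  simp only [not_lt] at h3 h5
  simp only [Finset.card_univ, not_lt] at h3 h4
  omega

theorem vanishesOff_of_mem_spechtIdeal {μ : YoungDiagram} {n : ℕ} {f : MvPolynomial (Fin n) K}
    (hf : f ∈ spechtIdeal K μ n) :
    VanishesOff (fun ν => ∃ u : List ℕ, (u : Multiset ℕ) = ν ∧ TailsGE (rowTail μ) u) f := by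
  intro φ _ hF
  have hle : spechtIdeal K μ n ≤ RingHom.ker (rename φ : MvPolynomial (Fin n) K →ₐ[K] _) := by
    refine Ideal.span_le.2 ?_
    rintro _ ⟨T, rfl⟩
    by_contra hne
    exact hF ⟨_, rfl, tailsGE_of_rename_spechtPolynomial_ne_zero T hne⟩
  exact hle hf

theorem rename_mem_spechtIdeal {μ : YoungDiagram} {n : ℕ} (τ : Equiv.Perm (Fin n))
    {f : MvPolynomial (Fin n) K} (hf : f ∈ spechtIdeal K μ n) :
    rename τ f ∈ spechtIdeal K μ n := by
  have hle : spechtIdeal K μ n ≤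
      (spechtIdeal K μ n).comap (rename τ : MvPolynomial (Fin n) K →ₐ[K] _) := by
    refine Ideal.span_le.2 ?_
    rintro _ ⟨T, rfl⟩
    refine Ideal.subset_span ⟨T.trans τ, ?_⟩
    simp [spechtPolynomial, map_prod]
  exact hle hf

/-- The product of the differences of the variables which are put into the same column by `c`. -/
noncomputable def columnPolynomial (K : Type*) [Field K] {n : ℕ} (c : Fin n → ℕ) :
    MvPolynomial (Fin n) K :=
  ∏ p : Fin n × Fin n with c p.1 = c p.2 ∧ p.1 < p.2, (X p.1 - X p.2)

/-- The number of variables which `c` puts into the same column as `k`, before `k`. -/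
def columnRank {n : ℕ} (c : Fin n → ℕ) (k : Fin n) : ℕ :=
  (Finset.univ.filter fun k' => c k' = c k ∧ k' < k).card

theorem columnRank_lt {n : ℕ} {c : Fin n → ℕ} {k l : Fin n} (h : c k = c l) (hkl : k < l) :
    columnRank c k < columnRank c l := by
  refine Finset.card_lt_card ((Finset.ssubset_iff_of_subset fun x hx => ?_).2 ⟨k, ?_, ?_⟩)
  · simp only [Finset.mem_filter, Finset.mem_univ, true_and] at hx ⊢
    exact ⟨hx.1.trans h, hx.2.trans hkl⟩
  · simp [h, hkl]
  · simp

theorem columnRank_lt_iff {n : ℕ} {c : Fin n → ℕ} {k l : Fin n} (h : c k = c l) :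
    columnRank c k < columnRank c l ↔ k < l := by
  refine ⟨fun hlt => not_le.1 fun hle => ?_, columnRank_lt h⟩
  rcases hle.eq_or_lt with rfl | hlt'
  · exact lt_irrefl _ hlt
  · exact lt_asymm hlt (columnRank_lt h.symm hlt')

theorem columnPolynomial_mem_of_card_eq {μ : YoungDiagram} {n : ℕ} (hn : μ.card = n)
    {c : Fin n → ℕ} (hc : ∀ j, (Finset.univ.filter fun k => c k = j).card = μ.colLen j) :
    columnPolynomial K c ∈ spechtIdeal K μ n := by
  have hmem : ∀ k, (columnRank c k, c k) ∈ μ.cells := by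
    intro k
    refine YoungDiagram.mem_iff_lt_colLen.2 ?_
    rw [← hc]
    refine Finset.card_lt_card ((Finset.ssubset_iff_of_subset fun x hx => ?_).2 ⟨k, ?_, ?_⟩)
    · simp only [Finset.mem_filter, Finset.mem_univ, true_and] at hx ⊢
      exact hx.1
    · simp
    · simp
  let e : Fin n → {c : ℕ × ℕ // c ∈ μ.cells} := fun k => ⟨(columnRank c k, c k), hmem k⟩
  have he : Function.Injective e := by
    intro k l h
    have h1 : columnRank c k = columnRank c l := congrArg (fun p => p.1.1) h
    have h2 : c k = c l := congrArg (fun p => p.1.2) h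
    rcases lt_trichotomy k l with h3 | h3 | h3
    · exact absurd h1 (columnRank_lt h2 h3).ne
    · exact h3
    · exact absurd h1 (columnRank_lt h2.symm h3).ne'
  have hbij : Function.Bijective e := (Fintype.bijective_iff_injective_and_card e).2
    ⟨he, by rw [Fintype.card_fin, Fintype.card_coe]; exact hn.symm⟩
  let E : Fin n ≃ {c : ℕ × ℕ // c ∈ μ.cells} := Equiv.ofBijective e hbij
  refine Ideal.subset_span ⟨E.symm, ?_⟩
  change spechtPolynomial K E.symm = columnPolynomial K c
  rw [spechtPolynomial, columnPolynomial]
  symm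
  refine Finset.prod_equiv (E.prodCongr E) (fun p => ?_) fun p _ => ?_
  · simp only [Finset.mem_filter, Finset.mem_univ, true_and]
    refine and_congr_right fun h => ?_
    exact (columnRank_lt_iff h).symm
  · simp

end Field

/-! ### Moving variables between columns. -/

section Exchange

variable {K : Type*} [Field K]

theorem columnPolynomial_split {n : ℕ} (c : Fin n → ℕ) (a : Fin n) :
    ∃ s : MvPolynomial (Fin n) K, s * s = 1 ∧ columnPolynomial K c =
      s * (∏ p : Fin n × Fin n with (c p.1 = c p.2 ∧ p.1 < p.2) ∧ ¬ (p.1 = a ∨ p.2 = a),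
        (X p.1 - X p.2)) * ∏ b with b ≠ a ∧ c b = c a, (X a - X b) := by
  classical
  refine ⟨∏ b with b ≠ a ∧ c b = c a, if a < b then 1 else -1, ?_, ?_⟩
  · rw [← Finset.prod_mul_distrib]
    refine Finset.prod_eq_one fun b _ => ?_
    split_ifs <;> simp
  · rw [columnPolynomial, ← Finset.prod_filter_mul_prod_filter_not
      (Finset.univ.filter fun p : Fin n × Fin n => c p.1 = c p.2 ∧ p.1 < p.2)
      (fun p => p.1 = a ∨ p.2 = a), Finset.filter_filter, Finset.filter_filter, mul_right_comm,
      ← Finset.prod_mul_distrib]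
    congr 1
    refine Finset.prod_bij' (fun p _ => if p.1 = a then p.2 else p.1)
      (fun b _ => if a < b then (a, b) else (b, a)) ?_ ?_ ?_ ?_ ?_
    · rintro ⟨x, y⟩ h
      simp only [Finset.mem_filter, Finset.mem_univ, true_and] at h ⊢
      obtain ⟨⟨h1, h2⟩, h3⟩ := h
      split_ifs with h4
      · subst h4
        exact ⟨h2.ne', h1.symm⟩
      · obtain rfl := h3.resolve_left h4
        exact ⟨h4, h1⟩
    · intro b h
      simp only [Finset.mem_filter, Finset.mem_univ, true_and] at h
      split_ifs with h4
      · simpa using ⟨h.2.symm, h4⟩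
      · have : b < a := lt_of_le_of_ne (not_lt.1 h4) h.1
        simpa using ⟨h.2, this⟩
    · rintro ⟨x, y⟩ h
      simp only [Finset.mem_filter, Finset.mem_univ, true_and] at h
      obtain ⟨⟨h1, h2⟩, h3⟩ := h
      by_cases h4 : x = a
      · subst h4
        simp [h2]
      · obtain rfl := h3.resolve_left h4
        simp [h4, not_lt.2 h2.le]
    · intro b h
      simp only [Finset.mem_filter, Finset.mem_univ, true_and] at h
      by_cases h4 : a < b
      · simp [h4]
      · simp [h4, h.1]
    · rintro ⟨x, y⟩ h
      simp only [Finset.mem_filter, Finset.mem_univ, true_and] at h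
      obtain ⟨⟨h1, h2⟩, h3⟩ := h
      by_cases h4 : x = a
      · subst h4
        simp [h2]
      · obtain rfl := h3.resolve_left h4
        simp [h4, not_lt.2 h2.le]

/-- Moving `a` only changes the factors involving `a`; `s` is the product of the two signs from
reordering the differences. -/
theorem columnPolynomial_mul_prod_eq {n : ℕ} (c : Fin n → ℕ) (a : Fin n) {l : ℕ}
    (hl : c a ≠ l) :
    ∃ s : MvPolynomial (Fin n) K,
      columnPolynomial K c * ∏ b with c b = l, (X a - X b) =
        s * columnPolynomial K (Function.update c a l) *
          ∏ b ∈ (Finset.univ.filter fun b => c b = c a).erase a, (X a - X b) := by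
  classical
  obtain ⟨s, hs, h⟩ := columnPolynomial_split (K := K) c a
  obtain ⟨s', hs', h'⟩ := columnPolynomial_split (K := K) (Function.update c a l) a
  have h1 : (Finset.univ.filter fun p : Fin n × Fin n =>
      (Function.update c a l p.1 = Function.update c a l p.2 ∧ p.1 < p.2) ∧
        ¬ (p.1 = a ∨ p.2 = a)) = Finset.univ.filter fun p : Fin n × Fin n =>
      (c p.1 = c p.2 ∧ p.1 < p.2) ∧ ¬ (p.1 = a ∨ p.2 = a) := by
    refine Finset.filter_congr fun p _ => and_congr_left fun hp => ?_
    rw [not_or] at hp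
    rw [Function.update_of_ne hp.1, Function.update_of_ne hp.2]
  have h2 : (Finset.univ.filter fun b =>
      b ≠ a ∧ Function.update c a l b = Function.update c a l a) =
      Finset.univ.filter fun b => c b = l := by
    refine Finset.filter_congr fun b _ => ?_
    rw [Function.update_self]
    by_cases hb : b = a
    · subst hb; simp [hl]
    · simp [hb]
  have h3 : ((Finset.univ.filter fun b => c b = c a).erase a) =
      Finset.univ.filter fun b => b ≠ a ∧ c b = c a := by
    ext b; simp
  rw [h1, h2] at h'
  refine ⟨s * s', ?_⟩
  rw [h, h', h3]
  linear_combination (-(s * (∏ p : Fin n × Fin n with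
    (c p.1 = c p.2 ∧ p.1 < p.2) ∧ ¬ (p.1 = a ∨ p.2 = a), (X p.1 - X p.2)) *
    (∏ b with b ≠ a ∧ c b = c a, (X a - X b)) * ∏ b with c b = l, (X a - X b))) * hs'

/-- The sum is the Lagrange formula for the leading coefficient of the monic polynomial `X ^ (|A| -
1 - |B|) * ∏ b ∈ B, (X - x b)` of degree `|A| - 1`. -/
theorem sum_lagrange_eq_one {L ι : Type*} [Field L] [DecidableEq ι] {x : ι → L} {A B : Finset ι}
    (hx : Set.InjOn x A) (hAB : B.card + 1 ≤ A.card) :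
    ∑ a ∈ A, (x a ^ (A.card - 1 - B.card) * ∏ b ∈ B, (x a - x b)) / ∏ b ∈ A.erase a, (x a - x b)
      = 1 := by
  have hmon : (Polynomial.X ^ (A.card - 1 - B.card) * Lagrange.nodal B x).Monic :=
    (Polynomial.monic_X_pow _).mul Lagrange.nodal_monic
  have hdeg : (Polynomial.X ^ (A.card - 1 - B.card) * Lagrange.nodal B x).degree =
      ((A.card - 1 : ℕ) : WithBot ℕ) := by
    rw [Polynomial.degree_mul, Polynomial.degree_X_pow, Lagrange.degree_nodal]
    norm_cast
    omega
  have h := Lagrange.leadingCoeff_eq_sum hx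
    (P := Polynomial.X ^ (A.card - 1 - B.card) * Lagrange.nodal B x) (by
      rw [hdeg]
      norm_cast
      omega)
  rw [hmon.leadingCoeff] at h
  rw [h]
  refine Finset.sum_congr rfl fun a _ => ?_
  rw [Polynomial.eval_mul, Polynomial.eval_pow, Polynomial.eval_X, Lagrange.eval_nodal]

/-- Multiplying the Lagrange identity by the column polynomial cancels the denominators, and writes
it as a combination of the polynomials with one `a` moved from column `j` to column `l`. -/
theorem columnPolynomial_mem_of_exchange {n : ℕ} {I : Ideal (MvPolynomial (Fin n) K)}
    {c : Fin n → ℕ} {j l : ℕ} (hjl : j ≠ l)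
    (hcard : (Finset.univ.filter fun k => c k = l).card + 1 ≤
      (Finset.univ.filter fun k => c k = j).card)
    (h : ∀ a, c a = j → columnPolynomial K (Function.update c a l) ∈ I) :
    columnPolynomial K c ∈ I := by
  classical
  set A := Finset.univ.filter fun k => c k = j with hA
  set B := Finset.univ.filter fun k => c k = l with hB
  set x : Fin n → FractionRing (MvPolynomial (Fin n) K) :=
    fun k => algebraMap (MvPolynomial (Fin n) K) _ (X k) with hx
  have hinj : Function.Injective
      (algebraMap (MvPolynomial (Fin n) K) (FractionRing (MvPolynomial (Fin n) K))) :=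
    IsFractionRing.injective _ _
  have hxinj : Function.Injective x := hinj.comp (X_injective)
  choose s hs using fun a : {a // c a = j} => columnPolynomial_mul_prod_eq (K := K) c a.1
    (l := l) (by rw [a.2]; exact hjl)
  have hsum : columnPolynomial K c = ∑ a ∈ A.attach,
      s ⟨a.1, (Finset.mem_filter.1 a.2).2⟩ * X a.1 ^ (A.card - 1 - B.card) *
        columnPolynomial K (Function.update c a.1 l) := by
    refine hinj ?_
    rw [map_sum]
    have h1 := sum_lagrange_eq_one (x := x) (A := A) (B := B) hxinj.injOn hcard
    rw [← mul_one (algebraMap _ _ (columnPolynomial K c)), ← h1, Finset.mul_sum,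
      ← Finset.sum_attach]
    refine Finset.sum_congr rfl fun a _ => ?_
    have haj : c a.1 = j := (Finset.mem_filter.1 a.2).2
    have h2 := congrArg (algebraMap (MvPolynomial (Fin n) K)
      (FractionRing (MvPolynomial (Fin n) K))) (hs ⟨a.1, haj⟩)
    simp only [haj, map_mul, map_prod, map_sub] at h2
    have h3 : ∏ b ∈ A.erase a.1, (x a.1 - x b) ≠ 0 := by
      refine Finset.prod_ne_zero_iff.2 fun b hb => sub_ne_zero.2 fun hab => ?_
      exact (Finset.mem_erase.1 hb).1 (hxinj hab).symm
    rw [← mul_div_assoc, div_eq_iff h3]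
    simp only [map_mul, map_pow]
    linear_combination (x a.1 ^ (A.card - 1 - B.card)) * h2
  rw [hsum]
  refine Ideal.sum_mem _ fun a _ => Ideal.mul_mem_left _ _ (h a.1 (Finset.mem_filter.1 a.2).2)

theorem card_filter_update {n : ℕ} (c : Fin n → ℕ) (a : Fin n) (l : ℕ) (p : ℕ → Prop)
    [DecidablePred p] :
    (Finset.univ.filter fun k => p (Function.update c a l k)).card + (if p (c a) then 1 else 0) =
      (Finset.univ.filter fun k => p (c k)).card + (if p l then 1 else 0) := by
  classical
  rw [Finset.card_filter, Finset.card_filter, ← Finset.add_sum_erase _ _ (Finset.mem_univ a),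
    ← Finset.add_sum_erase Finset.univ (fun k => if p (c k) then 1 else 0) (Finset.mem_univ a),
    Function.update_self, Finset.sum_congr rfl fun k hk => by
      rw [Function.update_of_ne (Finset.mem_erase.1 hk).1]]
  omega

theorem card_filter_lt_succ {n : ℕ} (c : Fin n → ℕ) (J : ℕ) :
    (Finset.univ.filter fun k => c k < J + 1).card =
      (Finset.univ.filter fun k => c k < J).card + (Finset.univ.filter fun k => c k = J).card := by
  rw [← Finset.card_union_of_disjoint]
  · congr 1
    ext k
    simp only [Finset.mem_filter, Finset.mem_univ, true_and, Finset.mem_union]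
    omega
  · refine Finset.disjoint_filter.2 fun k _ h1 h2 => ?_
    omega

theorem exists_exchange {n N : ℕ} {κ : ℕ → ℕ} (hκ : Antitone κ)
    (hN : ∀ j, N ≤ j → κ j = 0) (hsum : ∑ j ∈ Finset.range N, κ j = n) {c : Fin n → ℕ}
    (hc : ∀ J, ∑ j ∈ Finset.range J, κ j ≤ (Finset.univ.filter fun k => c k < J).card)
    (hne : ¬ ∀ j, (Finset.univ.filter fun k => c k = j).card = κ j) :
    ∃ j l, j < l ∧ l < N ∧ (Finset.univ.filter fun k => c k = l).card + 1 ≤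
        (Finset.univ.filter fun k => c k = j).card ∧
      ∀ J, j < J → J ≤ l →
        ∑ j ∈ Finset.range J, κ j + 1 ≤ (Finset.univ.filter fun k => c k < J).card := by
  classical
  have hheads : ∀ J, (Finset.univ.filter fun k => c k < J).card =
      ∑ j ∈ Finset.range J, (Finset.univ.filter fun k => c k = j).card := by
    intro J
    induction J with
    | zero => simp
    | succ J ih => rw [card_filter_lt_succ, ih, Finset.sum_range_succ]
  have hlt : ∀ k, c k < N := by
    have h1 := hc N
    rw [hsum] at h1
    have h2 : (Finset.univ.filter fun k => c k < N) = Finset.univ :=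
      (Finset.card_eq_iff_eq_univ _).1 (le_antisymm (Finset.card_le_univ _) (by simpa using h1))
    intro k
    have := Finset.mem_univ k
    rw [← h2] at this
    exact (Finset.mem_filter.1 this).2
  have hex : ∃ l, (Finset.univ.filter fun k => c k = l).card < κ l := by
    by_contra! H
    have h1 : ∑ j ∈ Finset.range N, κ j =
        ∑ j ∈ Finset.range N, (Finset.univ.filter fun k => c k = j).card := by
      refine le_antisymm (Finset.sum_le_sum fun j _ => H j) ?_
      rw [← hheads, hsum]
      exact (Finset.card_le_univ _).trans (by simp)
    have h2 := (Finset.sum_eq_sum_iff_of_le fun j _ => H j).1 h1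
    refine hne fun j => ?_
    by_cases hj : j < N
    · exact (h2 j (Finset.mem_range.2 hj)).symm
    · rw [hN j (not_lt.1 hj), Finset.card_eq_zero, Finset.filter_eq_empty_iff]
      intro k _ hk
      have := hlt k
      omega
  -- Take `l` to be the first column that is too short. Dominance forces an earlier column `j` that
  -- is too long, and no column before `l` is short, so the partial sums have slack from `j` to `l`.
  set l := Nat.find hex with hl
  have hl1 : (Finset.univ.filter fun k => c k = l).card < κ l := Nat.find_spec hex
  have hl2 : ∀ i < l, κ i ≤ (Finset.univ.filter fun k => c k = i).card :=
    fun i hi => not_lt.1 (Nat.find_min hex hi)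
  have hlN : l < N := by
    by_contra h
    rw [hN l (not_lt.1 h)] at hl1
    omega
  obtain ⟨j, hj, hj'⟩ : ∃ j < l, κ j < (Finset.univ.filter fun k => c k = j).card := by
    by_contra! H
    have h1 := hc (l + 1)
    rw [hheads, Finset.sum_range_succ, Finset.sum_range_succ] at h1
    have h2 : ∑ j ∈ Finset.range l, (Finset.univ.filter fun k => c k = j).card ≤
        ∑ j ∈ Finset.range l, κ j :=
      Finset.sum_le_sum fun i hi => H i (Finset.mem_range.1 hi)
    omega
  refine ⟨j, l, hj, hlN, ?_, fun J h1 h2 => ?_⟩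
  · have := hκ hj.le
    omega
  · induction J with
    | zero => omega
    | succ J ih =>
      rw [Finset.sum_range_succ, card_filter_lt_succ]
      rcases (Nat.lt_succ_iff.1 h1).eq_or_lt with rfl | h3
      · have := hc j
        omega
      · have := ih h3 (by omega)
        have := hl2 J (by omega)
        omega

/-- Each exchange moves a variable to a later column, preserving dominance and lowering the total of
the partial sums. -/
theorem columnPolynomial_mem_of_dominates {n N : ℕ} {I : Ideal (MvPolynomial (Fin n) K)}
    {κ : ℕ → ℕ} (hκ : Antitone κ) (hN : ∀ j, N ≤ j → κ j = 0)
    (hsum : ∑ j ∈ Finset.range N, κ j = n)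
    (hI : ∀ c : Fin n → ℕ, (∀ j, (Finset.univ.filter fun k => c k = j).card = κ j) →
      columnPolynomial K c ∈ I)
    {c : Fin n → ℕ}
    (hc : ∀ J, ∑ j ∈ Finset.range J, κ j ≤ (Finset.univ.filter fun k => c k < J).card) :
    columnPolynomial K c ∈ I := by
  classical
  induction hM : ∑ J ∈ Finset.range (N + 1), (Finset.univ.filter fun k => c k < J).card
    using Nat.strong_induction_on generalizing c with
  | _ M ih =>
    by_cases hne : ∀ j, (Finset.univ.filter fun k => c k = j).card = κ j
    · exact hI c hne
    obtain ⟨j, l, hjl, hlN, hcard, hheads⟩ := exists_exchange hκ hN hsum hc hne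
    refine columnPolynomial_mem_of_exchange hjl.ne hcard fun a ha => ?_
    have hupd := fun J => card_filter_update c a l fun x => x < J
    rw [ha] at hupd
    refine ih _ ?_ (fun J => ?_) rfl
    · rw [← hM]
      refine Finset.sum_lt_sum (fun J _ => ?_) ⟨j + 1, Finset.mem_range.2 (by omega), ?_⟩
      · have := hupd J
        split_ifs at this <;> omega
      · have := hupd (j + 1)
        split_ifs at this <;> omega
    · have h1 := hupd J
      have h2 := hc J
      have h3 := hheads J
      split_ifs at h1 <;> omega

end Exchange

/-! ### Columns attached to a lattice word. -/

/-- The column of a position is the number of later occurrences of its letter, so columns are filled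
from the end of the word and a letter is the height at which it lands. In the last clause, letters
below the height of column `J` fill exactly `J` of the first `J` columns, and all larger ones lie in
these columns. -/
theorem IsLattice.exists_columns {n : ℕ} {w : Fin n → ℕ} (hw : IsLattice (List.ofFn w)) :
    ∃ c : Fin n → ℕ,
      (∀ k, (Finset.univ.filter fun k' => c k' = c k ∧ k < k').card = w k) ∧
      (∀ i j, i < (Finset.univ.filter fun k => c k = j).card ↔ j < (List.ofFn w).count i) ∧
      ∀ J, (Finset.univ.filter fun k => c k < J).card =
        J * (Finset.univ.filter fun k => c k = J).card +
          (List.ofFn w).countP (fun x => (Finset.univ.filter fun k => c k = J).card ≤ x) := by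
  induction n with
  | zero => exact ⟨w, fun k => k.elim0, by simp, by simp⟩
  | succ n ih =>
    obtain ⟨w', a, rfl⟩ : ∃ (w' : Fin n → ℕ) (a : ℕ), w = Fin.cons a w' :=
      ⟨Fin.tail w, w 0, (Fin.cons_self_tail w).symm⟩
    rw [List.ofFn_cons] at hw ⊢
    obtain ⟨c, h1, h2, h3⟩ := ih hw.2
    have ha : (Finset.univ.filter fun k => c k = (List.ofFn w').count a).card = a := by
      refine le_antisymm (not_lt.1 fun h => ?_) (not_lt.1 fun h => ?_)
      · exact lt_irrefl _ ((h2 _ _).1 h)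
      · have h4 := hw.1 h.le
        have h5 := mt (h2 _ _).2 (lt_irrefl
          (Finset.univ.filter fun k => c k = (List.ofFn w').count a).card)
        simp only [List.count_cons, beq_iff_eq] at h4
        rw [if_neg h.ne'] at h4
        simp at h4
        omega
    have hcard : ∀ (p : ℕ → Prop) [DecidablePred p],
        (Finset.univ.filter fun k => p ((Fin.cons ((List.ofFn w').count a) c :
          Fin (n + 1) → ℕ) k)).card = (Finset.univ.filter fun k => p (c k)).card +
          if p ((List.ofFn w').count a) then 1 else 0 := by
      intro p _
      rw [Fin.card_filter_univ_succ]
      simp only [Fin.cons_zero, Fin.cons_succ]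
      split_ifs <;> rfl
    refine ⟨Fin.cons ((List.ofFn w').count a) c, fun k => ?_, fun i j => ?_, fun J => ?_⟩
    · refine Fin.cases ?_ (fun k => ?_) k
      · rw [Fin.card_filter_univ_succ]
        simpa [Function.comp_def] using ha
      · rw [Fin.card_filter_univ_succ]
        simpa [Function.comp_def] using h1 k
    · rw [hcard fun x => x = j, List.count_cons]
      have h4 := h2 i j
      simp only [beq_iff_eq]
      by_cases hj : (List.ofFn w').count a = j
      · subst hj
        rw [ha] at h4 ⊢
        split_ifs with h5 h5 <;> subst_vars <;> omega
      · rw [if_neg hj]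
        by_cases hi : a = i
        · subst hi
          simp only [if_true]
          omega
        · rw [if_neg hi]
          exact h4
    · rw [hcard fun x => x < J, hcard fun x => x = J, h3]
      by_cases hJ : (List.ofFn w').count a = J
      · have h4 := countP_succ_le (List.ofFn w') a
        rw [hJ] at ha
        rw [if_neg (by omega), if_pos hJ, ha, h4, hJ, List.countP_cons]
        simp
        ring
      · have h4 := h2 a J
        rw [if_neg hJ, List.countP_cons, Nat.add_zero]
        simp only [decide_eq_true_eq]
        split_ifs <;> omega

theorem sum_colLen {μ : YoungDiagram} (J : ℕ) :
    ∑ j ∈ Finset.range J, μ.colLen j = (μ.cells.filter fun c => c.2 < J).card := by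
  rw [Finset.card_eq_sum_card_fiberwise (f := Prod.snd) (t := Finset.range J) fun c hc => by
    simpa using (Finset.mem_filter.1 (Finset.mem_coe.1 hc)).2]
  refine Finset.sum_congr rfl fun j hj => ?_
  rw [YoungDiagram.colLen_eq_card, YoungDiagram.col, Finset.filter_filter]
  congr 1
  refine Finset.filter_congr fun c _ => ?_
  have := Finset.mem_range.1 hj
  constructor
  · intro h; omega
  · intro h; exact h.2

theorem sum_colLen_le {μ : YoungDiagram} (J i : ℕ) :
    ∑ j ∈ Finset.range J, μ.colLen j ≤ J * i + rowTail μ i := by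
  rw [sum_colLen]
  calc (μ.cells.filter fun c => c.2 < J).card
      ≤ (Finset.range i ×ˢ Finset.range J ∪ μ.cells.filter fun c => i ≤ c.1).card := by
        refine Finset.card_le_card fun c hc => ?_
        simp only [Finset.mem_filter, Finset.mem_union, Finset.mem_product,
          Finset.mem_range] at hc ⊢
        rcases lt_or_ge c.1 i with h | h
        · exact Or.inl ⟨h, hc.2⟩
        · exact Or.inr ⟨hc.1, h⟩
    _ ≤ _ := by
        refine (Finset.card_union_le _ _).trans ?_
        rw [Finset.card_product, Finset.card_range, Finset.card_range, mul_comm, rowTail]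

/-! ### Column polynomials with prescribed leading exponents. -/

section Field

variable {K : Type*} [Field K]

theorem columnPolynomial_mem_of_tailsGE {μ : YoungDiagram} {n : ℕ} (hn : μ.card = n)
    {w c : Fin n → ℕ} (ht : TailsGE (rowTail μ) (List.ofFn w))
    (hc : ∀ J, (Finset.univ.filter fun k => c k < J).card =
      J * (Finset.univ.filter fun k => c k = J).card +
        (List.ofFn w).countP (fun x => (Finset.univ.filter fun k => c k = J).card ≤ x)) :
    columnPolynomial K c ∈ spechtIdeal K μ n := by
  refine columnPolynomial_mem_of_dominates (N := μ.rowLen 0) (κ := μ.colLen)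
    (fun i j hij => μ.colLen_anti i j hij) (fun j hj => ?_) ?_
    (fun c hc => columnPolynomial_mem_of_card_eq hn hc) fun J => ?_
  · by_contra h
    have h1 : (0, j) ∈ μ := YoungDiagram.mem_iff_lt_colLen.2 (Nat.pos_of_ne_zero h)
    have h2 := YoungDiagram.mem_iff_lt_rowLen.1 h1
    omega
  · rw [sum_colLen, ← hn, YoungDiagram.card, Finset.filter_true_of_mem]
    intro x hx
    exact YoungDiagram.mem_iff_lt_rowLen.1 (μ.up_left_mem (Nat.zero_le _) le_rfl hx)
  · refine (sum_colLen_le J (Finset.univ.filter fun k => c k = J).card).trans ?_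
    rw [hc J]
    refine Nat.add_le_add_left ?_ _
    -- Height 0 is separate: `TailsGE` says nothing there, but both sides count all `n` boxes or
    -- letters.
    rcases (Finset.univ.filter fun k => c k = J).card with _ | i
    · rw [countP_zero_le, rowTail_zero, hn, List.length_ofFn]
    · exact ht i

theorem degree_X_sub_X {ι : Type*} (m : MonomialOrder ι) {a b : ι}
    (h : m.toSyn (Finsupp.single b 1) < m.toSyn (Finsupp.single a 1)) :
    m.degree (X a - X b : MvPolynomial ι K) = Finsupp.single a 1 := by
  rw [MonomialOrder.degree_sub_of_lt, MonomialOrder.degree_X]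
  rwa [MonomialOrder.degree_X, MonomialOrder.degree_X]

theorem columnPolynomial_ne_zero {n : ℕ} (c : Fin n → ℕ) : columnPolynomial K c ≠ 0 := by
  refine Finset.prod_ne_zero_iff.2 fun p hp => sub_ne_zero.2 fun h => ?_
  simp only [Finset.mem_filter, Finset.mem_univ, true_and] at hp
  exact hp.2.ne (X_injective h)

/-- Each factor is a difference of two variables, so only their relative order under `m` matters.
This makes one witness serve all orders that sort the variables alike. -/
theorem degree_rename_columnPolynomial {n : ℕ} {m : MonomialOrder (Fin n)}
    {τ : Equiv.Perm (Fin n)}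
    (hτ : ∀ k k', k < k' →
      m.toSyn (Finsupp.single (τ k') 1) < m.toSyn (Finsupp.single (τ k) 1))
    (c : Fin n → ℕ) (k : Fin n) :
    m.degree (rename τ (columnPolynomial K c)) (τ k) =
      (Finset.univ.filter fun k' => c k' = c k ∧ k < k').card := by
  rw [columnPolynomial, map_prod, MonomialOrder.degree_prod, Finsupp.finsetSum_apply]
  · have hterm : ∀ p ∈ Finset.univ.filter (fun p : Fin n × Fin n => c p.1 = c p.2 ∧ p.1 < p.2),
        m.degree (rename τ (X p.1 - X p.2 : MvPolynomial (Fin n) K)) (τ k) =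
          if p.1 = k then 1 else 0 := by
      intro p hp
      simp only [Finset.mem_filter, Finset.mem_univ, true_and] at hp
      rw [map_sub, rename_X, rename_X, degree_X_sub_X m (hτ _ _ hp.2), Finsupp.single_apply]
      simp
    rw [Finset.sum_congr rfl hterm, ← Finset.card_filter, Finset.filter_filter]
    refine Finset.card_bij' (fun p _ => p.2) (fun k' _ => (k, k')) ?_ ?_ ?_ ?_
    · rintro ⟨x, y⟩ h
      simp only [Finset.mem_filter, Finset.mem_univ, true_and] at h ⊢
      obtain ⟨h, rfl⟩ := h
      exact ⟨h.1.symm, h.2⟩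
    · intro y h
      simp only [Finset.mem_filter, Finset.mem_univ, true_and] at h ⊢
      exact ⟨⟨h.1.symm, h.2⟩, trivial⟩
    · rintro ⟨x, y⟩ h
      simp only [Finset.mem_filter, Finset.mem_univ, true_and] at h ⊢
      rw [h.2]
    · intro y h
      rfl
  · intro p hp
    simp only [Finset.mem_filter, Finset.mem_univ, true_and] at hp
    rw [map_sub, rename_X, rename_X]
    exact sub_ne_zero.2 fun h => hp.2.ne (τ.injective (X_injective h))

theorem exists_mem_spechtIdeal_degree_eq {μ : YoungDiagram} {n : ℕ} (hn : μ.card = n)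
    {m : MonomialOrder (Fin n)} {τ : Equiv.Perm (Fin n)}
    (hτ : ∀ k k', k < k' →
      m.toSyn (Finsupp.single (τ k') 1) < m.toSyn (Finsupp.single (τ k) 1))
    {w : Fin n → ℕ} (hw : IsLattice (List.ofFn w)) (ht : TailsGE (rowTail μ) (List.ofFn w)) :
    ∃ f ∈ spechtIdeal K μ n, f ≠ 0 ∧ ∀ k, m.degree f (τ k) = w k := by
  obtain ⟨c, h1, -, h3⟩ := hw.exists_columns
  refine ⟨rename τ (columnPolynomial K c),
    rename_mem_spechtIdeal τ (columnPolynomial_mem_of_tailsGE hn ht h3),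
    (map_ne_zero_iff _ (rename_injective _ τ.injective)).2 (columnPolynomial_ne_zero c),
    fun k => ?_⟩
  rw [degree_rename_columnPolynomial hτ, h1]

end Field

/-! ### Comparison of initial ideals. -/

section InitialIdeal

variable {K : Type*} [Field K] {n : ℕ}

theorem initialIdeal_eq_span_monomial (m : MonomialOrder (Fin n))
    (I : Ideal (MvPolynomial (Fin n) K)) :
    initialIdeal m I = Ideal.span ((fun d => monomial d (1 : K)) ''
      {d | ∃ f ∈ I, f ≠ 0 ∧ m.degree f = d}) := by
  refine le_antisymm (Ideal.span_le.2 ?_) (Ideal.span_le.2 ?_)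
  · rintro _ ⟨f, hf, rfl⟩
    rcases eq_or_ne f 0 with rfl | h0
    · simp
    · rw [MonomialOrder.leadingTerm, ← mul_one (m.leadingCoeff f), ← C_mul_monomial]
      exact Ideal.mul_mem_left _ _ (Ideal.subset_span ⟨_, ⟨f, hf, h0, rfl⟩, rfl⟩)
  · rintro _ ⟨_, ⟨f, hf, h0, rfl⟩, rfl⟩
    have h1 : monomial (m.degree f) (1 : K) =
        C (m.leadingCoeff f)⁻¹ * m.leadingTerm f := by
      rw [MonomialOrder.leadingTerm, C_mul_monomial,
        inv_mul_cancel₀ (m.leadingCoeff_ne_zero_iff.2 h0)]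
    simp only [h1]
    exact Ideal.mul_mem_left _ _ (Ideal.subset_span ⟨f, hf, rfl⟩)

theorem monomial_mem_initialIdeal {m : MonomialOrder (Fin n)}
    {I : Ideal (MvPolynomial (Fin n) K)} {e : Fin n →₀ ℕ} :
    monomial e (1 : K) ∈ initialIdeal m I ↔ ∃ f ∈ I, f ≠ 0 ∧ m.degree f ≤ e := by
  classical
  rw [initialIdeal_eq_span_monomial, mem_ideal_span_monomial_image,
    support_monomial, if_neg one_ne_zero]
  simp [and_assoc]

theorem initialIdeal_le_iff {m m' : MonomialOrder (Fin n)}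
    {I : Ideal (MvPolynomial (Fin n) K)} :
    initialIdeal m I ≤ initialIdeal m' I ↔
      ∀ f ∈ I, f ≠ 0 → ∃ g ∈ I, g ≠ 0 ∧ m'.degree g ≤ m.degree f := by
  refine ⟨fun h f hf h0 => ?_, fun h => ?_⟩
  · exact monomial_mem_initialIdeal.1 (h (monomial_mem_initialIdeal.2 ⟨f, hf, h0, le_rfl⟩))
  · rw [initialIdeal_eq_span_monomial m]
    refine Ideal.span_le.2 ?_
    rintro _ ⟨_, ⟨f, hf, h0, rfl⟩, rfl⟩
    exact monomial_mem_initialIdeal.2 (h f hf h0)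

/-- Standard monomials for either order form a basis of the quotient by `I`, so nested initial
ideals agree. Concretely, a monomial in the larger but not the smaller one, minus its remainder `r`
for `m'`, is a nonzero element of `I` with no term in the smaller initial ideal. -/
theorem initialIdeal_eq_of_le {m m' : MonomialOrder (Fin n)}
    {I : Ideal (MvPolynomial (Fin n) K)} (h : initialIdeal m I ≤ initialIdeal m' I) :
    initialIdeal m I = initialIdeal m' I := by
  classical
  refine le_antisymm h (initialIdeal_le_iff.2 fun f hf h0 => ?_)
  by_contra! H
  have hB : ∀ b ∈ {b | b ∈ I ∧ b ≠ 0}, IsUnit (m'.leadingCoeff b) := fun b hb =>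
    (m'.leadingCoeff_ne_zero_iff.2 hb.2).isUnit
  obtain ⟨g, r, hfr, -, hr⟩ := m'.div_set hB (monomial (m'.degree f) (1 : K))
  have hmem : monomial (m'.degree f) (1 : K) - r ∈ I := by
    rw [hfr, add_sub_cancel_right, Finsupp.linearCombination_apply]
    exact Ideal.sum_mem _ fun b _ => Ideal.mul_mem_left _ _ b.2.1
  have hdr : m'.degree f ∉ r.support := fun hd => hr _ hd f ⟨hf, h0⟩ le_rfl
  have hne : monomial (m'.degree f) (1 : K) - r ≠ 0 := by
    intro h1
    rw [sub_eq_zero] at h1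
    rw [← h1] at hdr
    simp at hdr
  have hlead := m.degree_mem_support hne
  rcases Finset.mem_union.1 (support_sub _ _ _ hlead) with h1 | h1
  · have h2 : m.degree (monomial (m'.degree f) (1 : K) - r) = m'.degree f := by
      simpa using support_monomial_subset h1
    exact H _ hmem hne h2.le
  · obtain ⟨g', hg', hg0, hle⟩ := initialIdeal_le_iff.1 h _ hmem hne
    exact hr _ h1 g' ⟨hg', hg0⟩ hle

end InitialIdeal

/-! ### Lexicographic orders and sorting of the variables. -/

section LexOrder

variable {n : ℕ}

theorem lexOrder_toSyn_mapDomain (σ : Equiv.Perm (Fin n)) (e : Fin n →₀ ℕ) :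
    (lexOrder σ).toSyn (e.mapDomain (Fin.revPerm.trans σ)) = MonomialOrder.lex.toSyn e := by
  change MonomialOrder.lex.toSyn (Finsupp.domCongr (σ.symm.trans Fin.revPerm) _) = _
  congr 1
  ext k
  rw [Finsupp.domCongr_apply, Finsupp.equivMapDomain_eq_mapDomain, ← Finsupp.mapDomain_comp]
  have : (σ.symm.trans Fin.revPerm : Fin n → Fin n) ∘ (Fin.revPerm.trans σ) = id := by
    ext k; simp
  rw [this, Finsupp.mapDomain_id]

theorem lexOrder_single_lt (σ : Equiv.Perm (Fin n)) {k k' : Fin n} (h : k < k') :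
    (lexOrder σ).toSyn (Finsupp.single (Fin.revPerm.trans σ k') 1) <
      (lexOrder σ).toSyn (Finsupp.single (Fin.revPerm.trans σ k) 1) := by
  rw [← Finsupp.mapDomain_single, ← Finsupp.mapDomain_single, lexOrder_toSyn_mapDomain,
    lexOrder_toSyn_mapDomain]
  exact Finsupp.Lex.single_lt_iff.2 h

theorem lexOrder_degree_rename {K : Type*} [Field K] (σ : Equiv.Perm (Fin n))
    (f : MvPolynomial (Fin n) K) (k : Fin n) :
    (lexOrder σ).degree (rename (Fin.revPerm.trans σ) f) (Fin.revPerm.trans σ k) =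
      MonomialOrder.lex.degree f k := by
  classical
  have hinj : Function.Injective (Fin.revPerm.trans σ) := (Fin.revPerm.trans σ).injective
  suffices h : (lexOrder σ).degree (rename (Fin.revPerm.trans σ) f) =
      (MonomialOrder.lex.degree f).mapDomain (Fin.revPerm.trans σ) by
    rw [h, Finsupp.mapDomain_apply hinj]
  rcases eq_or_ne f 0 with rfl | h0
  · simp
  refine (lexOrder σ).toSyn.injective (le_antisymm ?_ ((lexOrder σ).le_degree ?_))
  · rw [MonomialOrder.degree_le_iff, support_rename_of_injective hinj]
    intro d hd
    obtain ⟨e, he, rfl⟩ := Finset.mem_image.1 hd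
    rw [lexOrder_toSyn_mapDomain, lexOrder_toSyn_mapDomain]
    exact MonomialOrder.lex.le_degree he
  · rw [support_rename_of_injective hinj]
    exact Finset.mem_image_of_mem _ (MonomialOrder.lex.degree_mem_support h0)

theorem exists_sorting_perm (m : MonomialOrder (Fin n)) :
    ∃ σ : Equiv.Perm (Fin n), ∀ k k', k < k' →
      m.toSyn (Finsupp.single (Fin.revPerm.trans σ k') 1) <
        m.toSyn (Finsupp.single (Fin.revPerm.trans σ k) 1) := by
  set v : Fin n → m.syn := fun i => m.toSyn (Finsupp.single i 1) with hv
  have hvi : Function.Injective v := fun a b h =>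
    Finsupp.single_left_injective one_ne_zero (m.toSyn.injective h)
  refine ⟨Tuple.sort v, fun k k' h => ?_⟩
  exact ((Tuple.monotone_sort v).strictMono_of_injective
    (hvi.comp (Tuple.sort v).injective)) (Fin.rev_lt_rev.2 h)

end LexOrder

/-! ### Description of the initial ideals and injectivity. -/

section Main

variable {K : Type*} [Field K] {n : ℕ} {μ : YoungDiagram}

theorem exists_isLattice_le_lexOrder_degree (σ : Equiv.Perm (Fin n))
    {f : MvPolynomial (Fin n) K} (hf : f ∈ spechtIdeal K μ n) (h0 : f ≠ 0) :
    ∃ w : Fin n → ℕ, IsLattice (List.ofFn w) ∧ TailsGE (rowTail μ) (List.ofFn w) ∧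
      ∀ k, w k ≤ (lexOrder σ).degree f (Fin.revPerm.trans σ k) := by
  set τ := Fin.revPerm.trans σ with hτ
  have hfτ : f = rename τ (rename τ.symm f) := by
    rw [rename_rename, Equiv.self_comp_symm, rename_id_apply]
  have h1 : rename τ.symm f ≠ 0 := fun h => h0 (by rw [hfτ, h, map_zero])
  obtain ⟨w, hle, hw, u, hu, ht⟩ := (vanishesOff_of_mem_spechtIdeal
    (rename_mem_spechtIdeal τ.symm hf)).exists_isLattice_le_degree h1
  refine ⟨w, hw, ht.of_perm (Multiset.coe_eq_coe.1 hu).symm, fun k => ?_⟩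
  rw [hfτ, hτ, lexOrder_degree_rename]
  exact hle k

/-- The word below a lexicographic leading exponent is itself the `m`-leading exponent of a column
polynomial in the ideal; this gives one inclusion, which suffices. -/
theorem initialIdeal_lexOrder_eq (hn : μ.card = n) {m : MonomialOrder (Fin n)}
    {σ : Equiv.Perm (Fin n)} (hσ : ∀ k k', k < k' →
      m.toSyn (Finsupp.single (Fin.revPerm.trans σ k') 1) <
        m.toSyn (Finsupp.single (Fin.revPerm.trans σ k) 1)) :
    initialIdeal (lexOrder σ) (spechtIdeal K μ n) = initialIdeal m (spechtIdeal K μ n) := by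
  refine initialIdeal_eq_of_le (initialIdeal_le_iff.2 fun f hf h0 => ?_)
  obtain ⟨w, hw, ht, hle⟩ := exists_isLattice_le_lexOrder_degree σ hf h0
  obtain ⟨g, hg, hg0, hdeg⟩ := exists_mem_spechtIdeal_degree_eq (K := K) hn hσ hw ht
  refine ⟨g, hg, hg0, fun i => ?_⟩
  rw [← (Fin.revPerm.trans σ).apply_symm_apply i, hdeg]
  exact hle _

theorem monomial_mem_initialIdeal_lexOrder (hn : μ.card = n) (σ : Equiv.Perm (Fin n))
    (e : Fin n →₀ ℕ) :
    monomial e (1 : K) ∈ initialIdeal (lexOrder σ) (spechtIdeal K μ n) ↔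
      (e : Fin n → ℕ) ∈ wordExponents (rowTail μ) (List.ofFn (Fin.revPerm.trans σ)) := by
  rw [monomial_mem_initialIdeal]
  constructor
  · rintro ⟨f, hf, h0, hle⟩
    obtain ⟨w, hw, ht, hwle⟩ := exists_isLattice_le_lexOrder_degree σ hf h0
    have hcomp : (w ∘ (Fin.revPerm.trans σ).symm) ∘ (Fin.revPerm.trans σ) = w := by
      ext k; simp
    refine ⟨w ∘ (Fin.revPerm.trans σ).symm, fun x => ?_, ?_, ?_⟩
    · refine le_trans ?_ (hle x)
      have := hwle ((Fin.revPerm.trans σ).symm x)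
      rwa [Equiv.apply_symm_apply] at this
    · rwa [List.map_ofFn, hcomp]
    · rwa [List.map_ofFn, hcomp]
  · rintro ⟨w, hle, hw, ht⟩
    rw [List.map_ofFn] at hw ht
    obtain ⟨g, hg, hg0, hdeg⟩ := exists_mem_spechtIdeal_degree_eq (K := K) hn
      (fun k k' => lexOrder_single_lt σ) hw ht
    refine ⟨g, hg, hg0, fun i => ?_⟩
    rw [← (Fin.revPerm.trans σ).apply_symm_apply i, hdeg]
    exact hle _

theorem initialIdeal_lexOrder_injective (hn : μ.card = n)
    (h : ∃ i : ℕ, μ.rowLen i = μ.rowLen (i + 1) ∧ 0 < μ.rowLen (i + 1)) :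
    Function.Injective fun σ : Equiv.Perm (Fin n) =>
      initialIdeal (lexOrder σ) (spechtIdeal K μ n) := by
  obtain ⟨i, hi, hpos⟩ := h
  intro σ σ' hσ
  have hexp : wordExponents (rowTail μ) (List.ofFn (Fin.revPerm.trans σ)) =
      wordExponents (rowTail μ) (List.ofFn (Fin.revPerm.trans σ')) := by
    ext e
    have h1 := monomial_mem_initialIdeal_lexOrder (K := K) hn σ (Finsupp.equivFunOnFinite.symm e)
    have h2 := monomial_mem_initialIdeal_lexOrder (K := K) hn σ' (Finsupp.equivFunOnFinite.symm e)
    simp only at hσ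
    rw [hσ] at h1
    exact h1.symm.trans h2
  have hnd : ∀ σ : Equiv.Perm (Fin n), (List.ofFn (Fin.revPerm.trans σ)).Nodup := fun σ =>
    List.nodup_ofFn.2 (Equiv.injective _)
  have hperm : (List.ofFn (Fin.revPerm.trans σ)).Perm (List.ofFn (Fin.revPerm.trans σ')) := by
    refine (List.perm_ext_iff_of_nodup (hnd σ) (hnd σ')).2 fun x => ?_
    rw [List.mem_ofFn, List.mem_ofFn]
    exact iff_of_true (Equiv.surjective _ x) (Equiv.surjective _ x)
  have h0 := rowTail_eq μ 0
  have hr : 0 < μ.rowLen 0 := hpos.trans_le (μ.rowLen_anti 0 (i + 1) (Nat.zero_le _))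
  rw [rowTail_zero, hn] at h0
  have hlist := eq_of_wordExponents_eq (rowTail_eq μ) hi hpos (rowTail_pos_add_le μ) (hnd σ)
    hperm (by rw [List.length_ofFn]; simp only [Nat.zero_add] at h0; omega)
    (by rw [List.length_ofFn, rowTail_zero, hn]) hexp
  have hfun := List.ofFn_injective hlist
  ext k
  have := congrFun hfun (Fin.rev k)
  simpa using congrArg Fin.val this

end Main

end SpechtIdeal

/-- `μ` is the Young diagram of a partition of `n` with row lengths `μ.rowLen 0 ≥ μ.rowLen 1 ≥ ⋯`,
two consecutive ones being equal and positive. -/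
theorem proposition3p1 (K : Type*) [Field K] (n : ℕ) (μ : YoungDiagram) (hn : μ.card = n)
    (h : ∃ i : ℕ, μ.rowLen i = μ.rowLen (i + 1) ∧ 0 < μ.rowLen (i + 1)) :
    (Set.range fun m : MonomialOrder.{0, 0} (Fin n) =>
        SpechtIdeal.initialIdeal m (SpechtIdeal.spechtIdeal K μ n)).ncard = n.factorial ∧
    (Set.range fun m : MonomialOrder.{0, 0} (Fin n) =>
        SpechtIdeal.initialIdeal m (SpechtIdeal.spechtIdeal K μ n)) =
      (Set.range fun σ : Equiv.Perm (Fin n) =>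
        SpechtIdeal.initialIdeal (SpechtIdeal.lexOrder σ) (SpechtIdeal.spechtIdeal K μ n)) ∧
    Function.Injective fun σ : Equiv.Perm (Fin n) =>
        SpechtIdeal.initialIdeal (SpechtIdeal.lexOrder σ) (SpechtIdeal.spechtIdeal K μ n) := by
  have hinj := SpechtIdeal.initialIdeal_lexOrder_injective (K := K) hn h
  have hrange : (Set.range fun m : MonomialOrder.{0, 0} (Fin n) =>
        SpechtIdeal.initialIdeal m (SpechtIdeal.spechtIdeal K μ n)) =
      (Set.range fun σ : Equiv.Perm (Fin n) =>
        SpechtIdeal.initialIdeal (SpechtIdeal.lexOrder σ) (SpechtIdeal.spechtIdeal K μ n)) := by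
    refine Set.Subset.antisymm ?_ ?_
    · rintro _ ⟨m, rfl⟩
      obtain ⟨σ, hσ⟩ := SpechtIdeal.exists_sorting_perm m
      exact ⟨σ, SpechtIdeal.initialIdeal_lexOrder_eq hn hσ⟩
    · rintro _ ⟨σ, rfl⟩
      exact ⟨SpechtIdeal.lexOrder σ, rfl⟩
  refine ⟨?_, hrange, hinj⟩
  rw [hrange, Set.ncard_range_of_injective hinj, Nat.card_eq_fintype_card, Fintype.card_perm,
    Fintype.card_fin]
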